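/- Let $\mathrm I,\mathrm X,\mathrm Y,\mathrm Z$ be the single-qubit Pauli matrices and let $\mathcal P_m=\{\mathrm I,\mathrm X,\mathrm Y,\mathrm Z\}^{\otimes m}$. Let $\mathcal G_n$ be the $n$-qubit Clifford group, that is, the group of unitaries $C$ on $n$ qubits that normalize the Pauli group $\{\pm1,\pm i\}\cdot\mathcal P_n$. For an operator $E$ write $\mathcal E_E(\rho)=E\rho E^\dagger$; for $P\in\mathcal P_n$ this is the Pauli channel $\mathcal E_P(\rho)=P\rho P$. For a unitary $U$ on $n$ qubits let $\mathcal Q_U=\langle\{P\in\mathcal P_n : \mathrm{tr}[PU]\neq 0\}\rangle$ be the generated group, let $\mathcal G_{n,\mathcal Q_U}=\{C\in\mathcal G_n : [C,P]=0\ \text{for all } P\in\mathcal Q_U\}$, and let $$\mathscr T_{\mathcal Q_U}(\mathcal N)=\mathop{\mathbb E}_{D\in\mathcal G_{n,\mathcal Q_U}}\left[\mathcal D^\dagger\circ\mathcal N\circ\mathcal D\right],\qquad \mathcal D(\rho)=D\rho D^\dagger,\quad \mathcal D^\dagger(\rho)=D^\dagger\rho D,$$ where the average is uniform over $\mathcal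 G_{n,\mathcal Q_U}$ modulo global phases (a finite group). All averages below are uniform over the indicated finite sets. **Theorem.** Let $U$ be an arbitrary unitary on $n$ qubits. There are $n_1,n_2,n_3\ge 0$ with $n_1+n_2+n_3=n$ and $W\in\mathcal G_n$ such that, up to phases, $$\mathcal Q_U=W^\dagger\left(\{\mathrm I,\mathrm X,\mathrm Y,\mathrm Z\}^{\otimes n_1}\otimes\{\mathrm I,\mathrm Z\}^{\otimes n_2}\otimes\{\mathrm I\}^{\otimes n_3}\right)W .\tag{$*$}$$ For every such decomposition, every $P\in\mathcal P_n$ can be written, up to a phase, as $P=W^\dagger(P_1\otimes P_2\otimes P_3)W$ with $P_j\in\mathcal P_{n_j}$, and for every such expression of $P$ the following hold. 1. If $P_2\notin\{\mathrm I,\mathrm Z\}^{\otimes n_2}$, then $$\mathscr T_{\mathcal Q_U}(\mathcal E_P)=\mathop{\mathbb E}_{Q_2\in\{\mathrm I,\mathrm Z\}^{\otimes n_2},\ Q_3\in\mathcal P_{n_3}}\left[\mathcal E_{W^\dagger(P_1\otimes P_2Q_2\otimes Q_3)W}\right].$$ 2. If $P_2\in\{\mathrm I,\mathrm Z\}^{\otimes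 n_2}$ and $P_3\neq\mathrm I^{\otimes n_3}$, then $$\mathscr T_{\mathcal Q_U}(\mathcal E_P)=\mathop{\mathbb E}_{Q_2\in\{\mathrm I,\mathrm Z\}^{\otimes n_2},\ Q_3\in\mathcal P_{n_3}\setminus\{\mathrm I^{\otimes n_3}\}}\left[\mathcal E_{W^\dagger(P_1\otimes Q_2\otimes Q_3)W}\right].$$ 3. If $P_2\in\{\mathrm I,\mathrm Z\}^{\otimes n_2}$ and $P_3=\mathrm I^{\otimes n_3}$, then $\mathscr T_{\mathcal Q_U}(\mathcal E_P)=\mathcal E_P$. -/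

import Mathlib

noncomputable section

namespace SymClifford

open Matrix

/-- The computational basis of `n` qubits is indexed by bit strings `Fin n → Fin 2`; an operator on
`n` qubits is a `2 ^ n × 2 ^ n` complex matrix. -/
abbrev Op (n : ℕ) : Type := Matrix (Fin n → Fin 2) (Fin n → Fin 2) ℂ

/-- The unitary operators on `n` qubits. -/
abbrev UnitaryOp (n : ℕ) : Type := Matrix.unitaryGroup (Fin n → Fin 2) ℂ

/-- Equality of operators up to a global phase. -/
def PhaseEq {n : ℕ} (A B : Op n) : Prop := ∃ c : ℂ, ‖c‖ = 1 ∧ A = c • B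

/-! ### Pauli operators -/

/-- The labels of the four single-qubit Pauli operators. -/
inductive Letter : Type
  | I | X | Y | Z
  deriving DecidableEq

instance : Fintype Letter where
  elems := {.I, .X, .Y, .Z}
  complete a := by cases a <;> simp

/-- The single-qubit Pauli matrices. -/
def Letter.mat : Letter → Matrix (Fin 2) (Fin 2) ℂ
  | .I => 1
  | .X => !![0, 1; 1, 0]
  | .Y => !![0, -Complex.I; Complex.I, 0]
  | .Z => !![1, 0; 0, -1]

/-- The labels of the Pauli operators `{I, X, Y, Z}^{⊗ n}`. -/
abbrev PauliString (n : ℕ) : Type := Fin n → Letter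

/-- The operator `σ_{p 0} ⊗ ⋯ ⊗ σ_{p (n - 1)}` of a Pauli string `p`. -/
def pauli {n : ℕ} (p : PauliString n) : Op n :=
  Matrix.of fun x y => ∏ i, (p i).mat (x i) (y i)

/-- The string of the identity operator `I^{⊗ n}`. -/
def idString (n : ℕ) : PauliString n := fun _ => Letter.I

/-- The strings of the operators in `{I, Z}^{⊗ n}`. -/
def zStrings (n : ℕ) : Finset (PauliString n) :=
  Finset.univ.filter fun p => ∀ i, p i = Letter.I ∨ p i = Letter.Z

theorem Letter.exists_mul (a b : Letter) :
    ∃ (k : ℕ) (c : Letter), a.mat * b.mat = Complex.I ^ k • c.mat := by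
  cases a <;> cases b
  · exact ⟨0, .I, by simp [Letter.mat]⟩
  · exact ⟨0, .X, by simp [Letter.mat]⟩
  · exact ⟨0, .Y, by simp [Letter.mat]⟩
  · exact ⟨0, .Z, by simp [Letter.mat]⟩
  · exact ⟨0, .X, by simp [Letter.mat]⟩
  · exact ⟨0, .I, by simp [Letter.mat, Matrix.one_fin_two]⟩
  · exact ⟨1, .Z, by simp [Letter.mat]⟩
  · exact ⟨3, .Y, by simp [Letter.mat, pow_succ]⟩
  · exact ⟨0, .Y, by simp [Letter.mat]⟩
  · exact ⟨3, .Z, by simp [Letter.mat, pow_succ]⟩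
  · exact ⟨0, .I, by simp [Letter.mat, Matrix.one_fin_two]⟩
  · exact ⟨1, .X, by simp [Letter.mat]⟩
  · exact ⟨0, .Z, by simp [Letter.mat]⟩
  · exact ⟨1, .Y, by simp [Letter.mat]⟩
  · exact ⟨3, .X, by simp [Letter.mat, pow_succ]⟩
  · exact ⟨0, .I, by simp [Letter.mat, Matrix.one_fin_two]⟩

theorem Letter.mat_mul_self (a : Letter) : a.mat * a.mat = 1 := by
  cases a <;> simp [Letter.mat, Matrix.one_fin_two]

theorem Letter.star_mat (a : Letter) (x y : Fin 2) : star (a.mat y x) = a.mat x y := by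
  cases a <;> fin_cases x <;> fin_cases y <;> simp [Letter.mat]

theorem pauli_mul_apply {n : ℕ} (p q : PauliString n) (x y : Fin n → Fin 2) :
    (pauli p * pauli q) x y = ∏ i, ((p i).mat * (q i).mat) (x i) (y i) := by
  simp only [Matrix.mul_apply, pauli, Matrix.of_apply, Finset.prod_univ_sum,
    Fintype.piFinset_univ, Finset.prod_mul_distrib]

theorem exists_pauli_mul {n : ℕ} (p q : PauliString n) :
    ∃ (k : ℕ) (r : PauliString n), pauli p * pauli q = Complex.I ^ k • pauli r := by
  choose k c h using Letter.exists_mul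
  refine ⟨∑ i, k (p i) (q i), fun i => c (p i) (q i), ?_⟩
  ext x y
  rw [pauli_mul_apply]
  simp [h, pauli, Finset.prod_mul_distrib, Finset.prod_pow_eq_pow_sum]

theorem pauli_idString (n : ℕ) : pauli (idString n) = 1 := by
  ext x y
  simp only [pauli, idString, Letter.mat, Matrix.of_apply, Matrix.one_apply]
  rw [Finset.prod_ite_zero]
  simp [funext_iff]

theorem pauli_mul_self {n : ℕ} (p : PauliString n) : pauli p * pauli p = 1 := by
  rw [← pauli_idString]
  ext x y
  rw [pauli_mul_apply]
  simp only [Letter.mat_mul_self, pauli, idString, Matrix.of_apply]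
  rfl

theorem star_pauli {n : ℕ} (p : PauliString n) : star (pauli p) = pauli p := by
  ext x y
  rw [Matrix.star_apply]
  simp only [pauli, Matrix.of_apply, star_prod, Letter.star_mat]

/-- A Pauli operator as a unitary. -/
def pauliUnitary {n : ℕ} (p : PauliString n) : UnitaryOp n :=
  ⟨pauli p, by rw [Matrix.mem_unitaryGroup_iff, star_pauli, pauli_mul_self]⟩

/-- The `n`-qubit Pauli group `{1, i, -1, -i} · {I, X, Y, Z}^{⊗ n}`. -/
def pauliGroup (n : ℕ) : Subgroup (UnitaryOp n) where
  carrier := {V | ∃ (k : ℕ) (p : PauliString n), (V : Op n) = Complex.I ^ k • pauli p}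
  one_mem' := ⟨0, idString n, by simp [pauli_idString]⟩
  mul_mem' := by
    rintro V V' ⟨k, p, hV⟩ ⟨l, q, hV'⟩
    obtain ⟨m, r, h⟩ := exists_pauli_mul p q
    refine ⟨k + l + m, r, ?_⟩
    rw [Submonoid.coe_mul, hV, hV', smul_mul_smul_comm, h, smul_smul, ← pow_add, ← pow_add]
  inv_mem' := by
    rintro V ⟨k, p, hV⟩
    refine ⟨3 * k, p, ?_⟩
    have h : ((V⁻¹ : UnitaryOp n) : Op n) = star (V : Op n) := rfl
    rw [h, hV, star_smul, star_pauli, pow_mul, star_pow]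
    simp [pow_succ]

/-! ### Clifford operators -/

/-- The `n`-qubit Clifford group: the unitaries `C` with `C 𝒫 C† = 𝒫` for the Pauli group `𝒫`. -/
def cliffordGroup (n : ℕ) : Subgroup (UnitaryOp n) :=
  Subgroup.normalizer (pauliGroup n : Set (UnitaryOp n))

/-- The group `𝒬_U` generated by the `P ∈ {I, X, Y, Z}^{⊗ n}` with `tr[P U] ≠ 0`. -/
def symmetryGroup {n : ℕ} (U : UnitaryOp n) : Subgroup (UnitaryOp n) :=
  Subgroup.closure {V | ∃ p : PauliString n, (pauli p * (U : Op n)).trace ≠ 0 ∧ V = pauliUnitary p}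

/-- The `Q`-symmetric Clifford group: the Clifford unitaries that commute with every element
of `Q`. -/
def symmetricCliffordGroup {n : ℕ} (Q : Subgroup (UnitaryOp n)) : Subgroup (UnitaryOp n) :=
  cliffordGroup n ⊓ Subgroup.centralizer (Q : Set (UnitaryOp n))

/-! ### Channels and twirling -/

/-- The map `A ↦ E A E†` on operators. For a Pauli operator `E`, where `E† = E`, this is the Pauli
channel `E · E`. -/
def conjChannel {n : ℕ} (E : Op n) : Op n →ₗ[ℂ] Op n where
  toFun A := E * A * star E
  map_add' A B := by rw [mul_add, add_mul]
  map_smul' c A := by simp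

/-- The unitary channel `𝒟(A) = D A D†`, with inverse `𝒟†(A) = D† A D`. -/
def unitaryChannel {n : ℕ} (D : UnitaryOp n) : Op n ≃ₗ[ℂ] Op n where
  toLinearMap := conjChannel (D : Op n)
  invFun A := star (D : Op n) * A * (D : Op n)
  left_inv A := by
    have h : star (D : Op n) * (D : Op n) = 1 := Unitary.coe_star_mul_self D
    change star (D : Op n) * ((D : Op n) * A * star (D : Op n)) * (D : Op n) = A
    calc _ = (star (D : Op n) * (D : Op n)) * A * (star (D : Op n) * (D : Op n)) := by
          simp only [mul_assoc]
      _ = A := by rw [h, one_mul, mul_one]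
  right_inv A := by
    have h : (D : Op n) * star (D : Op n) = 1 := Unitary.coe_mul_star_self D
    change (D : Op n) * (star (D : Op n) * A * (D : Op n)) * star (D : Op n) = A
    calc _ = ((D : Op n) * star (D : Op n)) * A * ((D : Op n) * star (D : Op n)) := by
          simp only [mul_assoc]
      _ = A := by rw [h, one_mul, mul_one]

/-- The channels `𝒟` of the `Q`-symmetric Clifford unitaries `D`. Two unitaries have the same channel
exactly when they differ by a global phase, so this is the `Q`-symmetric Clifford group modulo
global phases. -/
def symmetricCliffordChannels {n : ℕ} (Q : Subgroup (UnitaryOp n)) : Set (Op n ≃ₗ[ℂ] Op n) :=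
  unitaryChannel '' (symmetricCliffordGroup Q : Set (UnitaryOp n))

theorem Letter.exists_expand (a b : Fin 2) : ∃ c : Letter → ℂ, ∀ u v : Fin 2,
    (if a = u ∧ b = v then (1 : ℂ) else 0) = ∑ l, c l * l.mat u v := by
  have hu : (Finset.univ : Finset Letter) = {.I, .X, .Y, .Z} := rfl
  fin_cases a <;> fin_cases b
  · refine ⟨fun | .I => 1 / 2 | .X => 0 | .Y => 0 | .Z => 1 / 2, fun u v => ?_⟩
    fin_cases u <;> fin_cases v <;> rw [hu] <;> simp [Letter.mat] <;> norm_num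
  · refine ⟨fun | .I => 0 | .X => 1 / 2 | .Y => Complex.I / 2 | .Z => 0, fun u v => ?_⟩
    fin_cases u <;> fin_cases v <;> rw [hu] <;> simp [Letter.mat, div_mul_eq_mul_div] <;> norm_num
  · refine ⟨fun | .I => 0 | .X => 1 / 2 | .Y => -Complex.I / 2 | .Z => 0, fun u v => ?_⟩
    fin_cases u <;> fin_cases v <;> rw [hu] <;> simp [Letter.mat, div_mul_eq_mul_div] <;> norm_num
  · refine ⟨fun | .I => 1 / 2 | .X => 0 | .Y => 0 | .Z => -1 / 2, fun u v => ?_⟩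
    fin_cases u <;> fin_cases v <;> rw [hu] <;> simp [Letter.mat] <;> norm_num

theorem span_pauli (n : ℕ) : Submodule.span ℂ (Set.range (pauli (n := n))) = ⊤ := by
  rw [eq_top_iff]
  intro A _
  rw [Matrix.matrix_eq_sum_single A]
  refine Submodule.sum_mem _ fun a _ => Submodule.sum_mem _ fun b _ => ?_
  choose c hc using Letter.exists_expand
  have h : Matrix.single a b (A a b) =
      ∑ p : PauliString n, (A a b * ∏ i, c (a i) (b i) (p i)) • pauli p := by
    ext u v
    have h1 : (if a = u ∧ b = v then (1 : ℂ) else 0) =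
        ∏ i, if a i = u i ∧ b i = v i then (1 : ℂ) else 0 := by
      rw [Finset.prod_ite_zero]
      simp [funext_iff, forall_and]
    have h2 : Matrix.single a b (A a b) u v = A a b * (if a = u ∧ b = v then (1 : ℂ) else 0) := by
      simp [Matrix.single_apply]
    rw [h2, h1]
    simp only [hc, Finset.prod_univ_sum, Fintype.piFinset_univ, Finset.mul_sum, Matrix.sum_apply,
      Matrix.smul_apply, pauli, Matrix.of_apply, Finset.prod_mul_distrib, smul_eq_mul, mul_assoc]
  rw [h]
  exact Submodule.sum_mem _ fun p _ =>
    Submodule.smul_mem _ _ (Submodule.subset_span (Set.mem_range_self p))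

theorem finite_symmetricCliffordChannels {n : ℕ} (Q : Subgroup (UnitaryOp n)) :
    (symmetricCliffordChannels Q).Finite := by
  let F : (Op n ≃ₗ[ℂ] Op n) → (PauliString n → Op n) := fun Φ p => Φ (pauli p)
  have hF : Function.Injective F := by
    intro Φ Ψ h
    apply LinearEquiv.toLinearMap_injective
    refine LinearMap.ext_on_range (v := pauli (n := n)) (span_pauli n) fun p => ?_
    exact congrFun h p
  have hS : (Set.range fun kp : Fin 4 × PauliString n =>
      Complex.I ^ (kp.1 : ℕ) • pauli kp.2).Finite := Set.finite_range _
  refine Set.Finite.of_finite_image ((Set.Finite.pi' fun _ : PauliString n => hS).subset ?_)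
    hF.injOn
  rintro _ ⟨_, ⟨D, hD, rfl⟩, rfl⟩ p
  have hp : pauliUnitary p ∈ pauliGroup n := ⟨0, p, by simp [pauliUnitary]⟩
  obtain ⟨k, q, h⟩ := (Subgroup.mem_normalizer_iff.mp hD.1 (pauliUnitary p)).mp hp
  refine ⟨(⟨k % 4, Nat.mod_lt _ (by norm_num)⟩, q), ?_⟩
  have hk : Complex.I ^ (k % 4) = Complex.I ^ k := by
    conv_rhs => rw [← Nat.mod_add_div k 4, pow_add, pow_mul, Complex.I_pow_four, one_pow, mul_one]
  change Complex.I ^ (k % 4) • pauli q = (D : Op n) * pauli p * star (D : Op n)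
  rw [hk, ← h]
  rfl

/-- The uniform average of `f` over a finite set. -/
def average {α V : Type*} [AddCommGroup V] [Module ℂ V] (s : Finset α) (f : α → V) : V :=
  (s.card : ℂ)⁻¹ • ∑ a ∈ s, f a

/-- The symmetric Clifford twirling `𝒯_Q(𝒩) = 𝔼_D [𝒟† ∘ 𝒩 ∘ 𝒟]`, where `D` is uniformly distributed
over the `Q`-symmetric Clifford group modulo global phases. -/
def twirl {n : ℕ} (Q : Subgroup (UnitaryOp n)) (N : Op n →ₗ[ℂ] Op n) : Op n →ₗ[ℂ] Op n :=
  average (finite_symmetricCliffordChannels Q).toFinset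
    fun D => D.symm.toLinearMap ∘ₗ N ∘ₗ D.toLinearMap

/-! ### Splitting the qubits into three blocks -/

/-- The tensor product `A ⊗ B ⊗ C` of operators on the first `n₁`, the next `n₂` and the last `n₃`
qubits. -/
def tensor {n n₁ n₂ n₃ : ℕ} (h : n₁ + n₂ + n₃ = n) (A : Op n₁) (B : Op n₂) (C : Op n₃) : Op n :=
  Matrix.of fun x y =>
    A (fun i => x (Fin.cast h (Fin.castAdd n₃ (Fin.castAdd n₂ i))))
        (fun i => y (Fin.cast h (Fin.castAdd n₃ (Fin.castAdd n₂ i)))) *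
      B (fun i => x (Fin.cast h (Fin.castAdd n₃ (Fin.natAdd n₁ i))))
        (fun i => y (Fin.cast h (Fin.castAdd n₃ (Fin.natAdd n₁ i)))) *
      C (fun i => x (Fin.cast h (Fin.natAdd (n₁ + n₂) i)))
        (fun i => y (Fin.cast h (Fin.natAdd (n₁ + n₂) i)))

/-- The operator `W† (A ⊗ B ⊗ C) W`. -/
def rotated {n n₁ n₂ n₃ : ℕ} (h : n₁ + n₂ + n₃ = n) (W : UnitaryOp n)
    (A : Op n₁) (B : Op n₂) (C : Op n₃) : Op n :=
  star (W : Op n) * tensor h A B C * (W : Op n)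

/-- `Q = W† ({I, X, Y, Z}^{⊗ n₁} ⊗ {I, Z}^{⊗ n₂} ⊗ {I}^{⊗ n₃}) W` up to phases: both sides contain the
same unitaries once all global phases are allowed. -/
def Decomposes {n n₁ n₂ n₃ : ℕ} (h : n₁ + n₂ + n₃ = n) (Q : Subgroup (UnitaryOp n))
    (W : UnitaryOp n) : Prop :=
  ∀ V : UnitaryOp n, (∃ R ∈ Q, PhaseEq (V : Op n) (R : Op n)) ↔
    ∃ (s₁ : PauliString n₁), ∃ s₂ ∈ zStrings n₂,
      PhaseEq (V : Op n) (rotated h W (pauli s₁) (pauli s₂) 1)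

end SymClifford

end

open SymClifford

noncomputable section

namespace SymClifford

/-! ### Pauli strings as an elementary abelian 2-group with a commutation sign -/

/-! Modulo phases the Pauli operators form an elementary abelian 2-group, written multiplicatively
as `PauliString n`. Commutation gives it a nondegenerate symplectic form `sign` with values ±1, and
the Clifford group acts on it preserving `sign`.

Let S be the group of strings of 𝒬_U. Conjugating a Pauli channel by a Clifford unitary gives the
Pauli channel of the moved string, and distinct strings have distinct channels
(`conjChannel_pauli_injective`). By orbit–stabilizer (`average_smul_eq`, `twirl_eq_average`), the
twirl of the channel of p is therefore the uniform average over the orbit of p under the Clifford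
unitaries commuting with S.

These orbits are known (`exists_fixing_smul_eq_iff`). A point of S is fixed. Outside S, an element C
of the group preserves the signs of p against S, so C • p stays outside S and p * (C • p) lies in
`perp S`. Conversely, any two strings outside S whose product is in `perp S` are joined by
symplectic transvections (1 + iσ_a)/√2 with a in `perp S`, since these commute exactly with S. One
transvection suffices if the strings anticommute, two otherwise (`exists_fixing_smul_eq`). This uses
that a string outside S anticommutes with something in `perp S`, checked explicitly for the standard
subgroups and transported by W. In block form `perp S` is I ⊗ {I,Z} ⊗ (everything), which gives the
three cases.

The decomposition itself is symplectic Gram–Schmidt (`exists_preimage_eq_std`): split off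
anticommuting pairs as (Z, X) on fresh qubits until what remains is commuting, then split off single
strings as Z. The moves come from the same transitivity lemma, which leaves the part already
standardized fixed. -/

/-- The product of two Pauli letters up to a phase. -/
def Letter.mul : Letter → Letter → Letter
  | .I, b => b
  | a, .I => a
  | .X, .X => .I
  | .X, .Y => .Z
  | .X, .Z => .Y
  | .Y, .X => .Z
  | .Y, .Y => .I
  | .Y, .Z => .X
  | .Z, .X => .Y
  | .Z, .Y => .X
  | .Z, .Z => .I

instance : CommGroup Letter where
  mul := Letter.mul
  one := .I
  inv a := a
  mul_assoc := by decide
  one_mul := by decide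
  mul_one := by decide
  inv_mul_cancel := by decide
  mul_comm := by decide

/-- The sign `ε` with `a b = ε b a` for two single-qubit Pauli operators. -/
def Letter.sign (a b : Letter) : ℤˣ := if a = 1 ∨ b = 1 ∨ a = b then 1 else -1

theorem Letter.sign_mul_left : ∀ a b c : Letter, (a * b).sign c = a.sign c * b.sign c := by
  decide

theorem Letter.sign_comm : ∀ a b : Letter, a.sign b = b.sign a := by decide

theorem Letter.mul_self : ∀ a : Letter, a * a = 1 := by decide

theorem Letter.exists_mat_mul (a b : Letter) :
    ∃ k : ℕ, a.mat * b.mat = Complex.I ^ k • (a * b).mat := by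
  cases a <;> cases b
  · exact ⟨0, by change _ = _ • Letter.mat .I; simp [Letter.mat]⟩
  · exact ⟨0, by change _ = _ • Letter.mat .X; simp [Letter.mat]⟩
  · exact ⟨0, by change _ = _ • Letter.mat .Y; simp [Letter.mat]⟩
  · exact ⟨0, by change _ = _ • Letter.mat .Z; simp [Letter.mat]⟩
  · exact ⟨0, by change _ = _ • Letter.mat .X; simp [Letter.mat]⟩
  · exact ⟨0, by change _ = _ • Letter.mat .I; simp [Letter.mat, Matrix.one_fin_two]⟩
  · exact ⟨1, by change _ = _ • Letter.mat .Z; simp [Letter.mat]⟩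
  · exact ⟨3, by change _ = _ • Letter.mat .Y; simp [Letter.mat, pow_succ]⟩
  · exact ⟨0, by change _ = _ • Letter.mat .Y; simp [Letter.mat]⟩
  · exact ⟨3, by change _ = _ • Letter.mat .Z; simp [Letter.mat, pow_succ]⟩
  · exact ⟨0, by change _ = _ • Letter.mat .I; simp [Letter.mat, Matrix.one_fin_two]⟩
  · exact ⟨1, by change _ = _ • Letter.mat .X; simp [Letter.mat]⟩
  · exact ⟨0, by change _ = _ • Letter.mat .Z; simp [Letter.mat]⟩
  · exact ⟨1, by change _ = _ • Letter.mat .Y; simp [Letter.mat]⟩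
  · exact ⟨3, by change _ = _ • Letter.mat .X; simp [Letter.mat, pow_succ]⟩
  · exact ⟨0, by change _ = _ • Letter.mat .I; simp [Letter.mat, Matrix.one_fin_two]⟩

theorem Letter.mat_mul_comm (a b : Letter) :
    a.mat * b.mat = ((a.sign b : ℤ) : ℂ) • (b.mat * a.mat) := by
  have h : ∀ a b : Letter, a.sign b = match a, b with
    | .I, _ => 1 | _, .I => 1 | .X, .X => 1 | .Y, .Y => 1 | .Z, .Z => 1 | _, _ => -1 := by decide
  rw [h]
  cases a <;> cases b <;> simp [Letter.mat]

theorem Letter.exists_sign_ne : ∀ a b : Letter, a ≠ b → ∃ c : Letter, a.sign c ≠ b.sign c := by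
  decide

/-- The sign `ε` with `p q = ε q p` for two Pauli operators. -/
def sign {n : ℕ} (p q : PauliString n) : ℤˣ := ∏ i, (p i).sign (q i)

variable {n : ℕ}

theorem string_mul_self (p : PauliString n) : p * p = 1 := funext fun i => (p i).mul_self

theorem sign_comm (p q : PauliString n) : sign p q = sign q p :=
  Finset.prod_congr rfl fun i _ => Letter.sign_comm (p i) (q i)

theorem sign_mul_left (p q r : PauliString n) : sign (p * q) r = sign p r * sign q r := by
  simp only [sign, Pi.mul_apply, Letter.sign_mul_left, Finset.prod_mul_distrib]

theorem sign_mul_right (p q r : PauliString n) : sign p (q * r) = sign p q * sign p r := by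
  rw [sign_comm, sign_mul_left, sign_comm q, sign_comm r]

theorem sign_one_left (p : PauliString n) : sign 1 p = 1 := by
  simp [sign, Letter.sign]

theorem sign_one_right (p : PauliString n) : sign p 1 = 1 := by
  rw [sign_comm, sign_one_left]

theorem sign_self (p : PauliString n) : sign p p = 1 := by
  simp [sign, Letter.sign]

theorem sign_mulSingle (i : Fin n) (a : Letter) (p : PauliString n) :
    sign (Pi.mulSingle i a) p = a.sign (p i) := by
  rw [sign, Finset.prod_eq_single i]
  · simp
  · intro j _ hj
    rw [Pi.mulSingle_eq_of_ne hj]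
    simp [Letter.sign]
  · simp

/-- Nondegeneracy of the form: strings supported on a single qubit detect each letter separately. -/
theorem sign_left_injective {p q : PauliString n} (h : ∀ r, sign p r = sign q r) : p = q := by
  by_contra hne
  obtain ⟨i, hi⟩ := Function.ne_iff.mp hne
  obtain ⟨c, hc⟩ := Letter.exists_sign_ne _ _ hi
  apply hc
  rw [Letter.sign_comm, Letter.sign_comm (q i), ← sign_mulSingle, ← sign_mulSingle, sign_comm,
    sign_comm _ q, h]

/-- The Pauli strings that commute with all elements of a subgroup. -/
def perp (S : Subgroup (PauliString n)) : Subgroup (PauliString n) where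
  carrier := {p | ∀ s ∈ S, sign p s = 1}
  one_mem' s _ := sign_one_left s
  mul_mem' hp hq s hs := by rw [sign_mul_left, hp s hs, hq s hs, one_mul]
  inv_mem' {p} hp s hs := by
    have h : p⁻¹ = p := inv_eq_of_mul_eq_one_left (string_mul_self p)
    rw [h]
    exact hp s hs

theorem exists_pauli_mul_eq (p q : PauliString n) :
    ∃ k : ℕ, pauli p * pauli q = Complex.I ^ k • pauli (p * q) := by
  choose k h using Letter.exists_mat_mul
  refine ⟨∑ i, k (p i) (q i), ?_⟩
  ext x y
  rw [pauli_mul_apply]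
  simp [h, pauli, Finset.prod_mul_distrib, Finset.prod_pow_eq_pow_sum]

theorem pauli_mul_comm (p q : PauliString n) :
    pauli p * pauli q = ((sign p q : ℤ) : ℂ) • (pauli q * pauli p) := by
  ext x y
  rw [Matrix.smul_apply, pauli_mul_apply, pauli_mul_apply]
  simp only [sign, Units.coe_prod, Int.cast_prod, smul_eq_mul, ← Finset.prod_mul_distrib]
  refine Finset.prod_congr rfl fun i _ => ?_
  rw [Letter.mat_mul_comm, Matrix.smul_apply, smul_eq_mul]

theorem pauli_ne_zero (p : PauliString n) : pauli p ≠ 0 := by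
  intro h
  have := pauli_mul_self p
  rw [h, zero_mul] at this
  exact zero_ne_one this

theorem pauli_mul_ne_zero (p q : PauliString n) : pauli p * pauli q ≠ 0 := by
  obtain ⟨k, hk⟩ := exists_pauli_mul_eq p q
  rw [hk]
  exact smul_ne_zero (pow_ne_zero _ Complex.I_ne_zero) (pauli_ne_zero _)

/-! ### Equality up to a phase -/

theorem PhaseEq.refl (A : Op n) : PhaseEq A A := ⟨1, by simp⟩

theorem PhaseEq.symm {A B : Op n} : PhaseEq A B → PhaseEq B A := by
  rintro ⟨c, hc, rfl⟩
  have h : c ≠ 0 := by rintro rfl; simp at hc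
  exact ⟨c⁻¹, by simp [hc], by rw [smul_smul, inv_mul_cancel₀ h, one_smul]⟩

theorem PhaseEq.trans {A B C : Op n} : PhaseEq A B → PhaseEq B C → PhaseEq A C := by
  rintro ⟨c, hc, rfl⟩ ⟨d, hd, rfl⟩
  exact ⟨c * d, by simp [hc, hd], smul_smul _ _ _⟩

theorem PhaseEq.mul {A B C D : Op n} : PhaseEq A B → PhaseEq C D → PhaseEq (A * C) (B * D) := by
  rintro ⟨c, hc, rfl⟩ ⟨d, hd, rfl⟩
  exact ⟨c * d, by simp [hc, hd], smul_mul_smul_comm _ _ _ _⟩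

theorem PhaseEq.conj {A B : Op n} (V W : Op n) (h : PhaseEq A B) :
    PhaseEq (V * A * W) (V * B * W) :=
  ((PhaseEq.refl V).mul h).mul (PhaseEq.refl W)

theorem phaseEq_I_pow (k : ℕ) (A : Op n) : PhaseEq (Complex.I ^ k • A) A :=
  ⟨Complex.I ^ k, by simp, rfl⟩

theorem phaseEq_pauli_mul (p q : PauliString n) :
    PhaseEq (pauli p * pauli q) (pauli (p * q)) := by
  obtain ⟨k, hk⟩ := exists_pauli_mul_eq p q
  rw [hk]
  exact phaseEq_I_pow k _

theorem PhaseEq.conjChannel_eq {A B : Op n} : PhaseEq A B → conjChannel A = conjChannel B := by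
  rintro ⟨c, hc, rfl⟩
  have h : c * Star.star c = 1 := by
    rw [Complex.star_def, Complex.mul_conj, Complex.normSq_eq_norm_sq, hc]
    simp
  ext1 X
  change c • B * X * Star.star (c • B) = B * X * Star.star B
  rw [star_smul, smul_mul_assoc, smul_mul_smul_comm, h, one_smul]

theorem conjChannel_pauli_apply (p q : PauliString n) :
    conjChannel (pauli p) (pauli q) = ((sign p q : ℤ) : ℂ) • pauli q := by
  change pauli p * pauli q * star (pauli p) = _
  rw [star_pauli, pauli_mul_comm, smul_mul_assoc, mul_assoc, pauli_mul_self, mul_one]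

/-- Every Pauli operator `pauli r` is an eigenvector of the channel of p with eigenvalue `sign p r`,
so the channel determines `sign p`, and nondegeneracy recovers p. -/
theorem conjChannel_pauli_injective :
    Function.Injective fun p : PauliString n => conjChannel (pauli p) := by
  intro p q h
  refine sign_left_injective fun r => ?_
  have := congrArg (fun N => N (pauli r)) h
  simp only [conjChannel_pauli_apply] at this
  exact Units.ext (Int.cast_injective (smul_left_injective ℂ (pauli_ne_zero r) this))

theorem phaseEq_pauli_iff {p q : PauliString n} : PhaseEq (pauli p) (pauli q) ↔ p = q :=
  ⟨fun h => conjChannel_pauli_injective h.conjChannel_eq, by rintro rfl; exact .refl _⟩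

/-! ### The action of the Clifford group on Pauli strings -/

theorem exists_string_of_mem_pauliGroup {V : UnitaryOp n} (hV : V ∈ pauliGroup n) :
    ∃ p : PauliString n, PhaseEq (V : Op n) (pauli p) := by
  obtain ⟨k, p, h⟩ := hV
  exact ⟨p, h ▸ phaseEq_I_pow k _⟩

theorem pauliUnitary_mem (p : PauliString n) : pauliUnitary p ∈ pauliGroup n :=
  ⟨0, p, by simp [pauliUnitary]⟩

theorem exists_clifford_conj (C : cliffordGroup n) (p : PauliString n) :
    ∃ q : PauliString n,
      PhaseEq (((C : UnitaryOp n) : Op n) * pauli p * star ((C : UnitaryOp n) : Op n)) (pauli q) :=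
  exists_string_of_mem_pauliGroup
    ((Subgroup.mem_normalizer_iff.mp C.2 (pauliUnitary p)).mp (pauliUnitary_mem p))

/-- The chosen string is unique by `phaseEq_pauli_iff`, so the choice is canonical and the action
laws can be checked up to phase. -/
instance : SMul (cliffordGroup n) (PauliString n) where
  smul C p := (exists_clifford_conj C p).choose

theorem phaseEq_smul (C : cliffordGroup n) (p : PauliString n) :
    PhaseEq (((C : UnitaryOp n) : Op n) * pauli p * star ((C : UnitaryOp n) : Op n)) (pauli (C • p)) :=
  (exists_clifford_conj C p).choose_spec

theorem smul_eq_iff {C : cliffordGroup n} {p q : PauliString n} : C • p = q ↔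
    PhaseEq (((C : UnitaryOp n) : Op n) * pauli p * star ((C : UnitaryOp n) : Op n)) (pauli q) :=
  ⟨fun h => h ▸ phaseEq_smul C p,
    fun h => phaseEq_pauli_iff.mp ((phaseEq_smul C p).symm.trans h)⟩

theorem unitary_conj_mul (C : UnitaryOp n) (A B : Op n) :
    (C : Op n) * (A * B) * star (C : Op n) =
      (C * A * star (C : Op n)) * (C * B * star (C : Op n)) := by
  have h : star (C : Op n) * (C : Op n) = 1 := Unitary.coe_star_mul_self C
  simp only [mul_assoc]
  rw [← mul_assoc (star (C : Op n)) (C : Op n), h, one_mul]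

instance : MulDistribMulAction (cliffordGroup n) (PauliString n) where
  one_smul p := by
    rw [smul_eq_iff]
    simpa using PhaseEq.refl (pauli p)
  mul_smul C D p := by
    rw [smul_eq_iff]
    refine PhaseEq.trans ?_ (phaseEq_smul C (D • p))
    have := (phaseEq_smul D p).conj (C : UnitaryOp n) (star ((C : UnitaryOp n) : Op n))
    simpa [mul_assoc] using this
  smul_one C := by
    rw [smul_eq_iff]
    have h : ((C : UnitaryOp n) : Op n) * star ((C : UnitaryOp n) : Op n) = 1 :=
      Unitary.coe_mul_star_self _
    have h1 : pauli (1 : PauliString n) = 1 := pauli_idString n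
    rw [h1, mul_one, h]
    exact .refl _
  smul_mul C p q := by
    rw [smul_eq_iff]
    refine ((phaseEq_pauli_mul p q).symm.conj _ _).trans ?_
    rw [unitary_conj_mul]
    exact ((phaseEq_smul C p).mul (phaseEq_smul C q)).trans (phaseEq_pauli_mul _ _)

/-- Conjugating the commutation relation of p and q gives the same relation for their images; the
phases appear equally on both sides. -/
theorem sign_smul_smul (C : cliffordGroup n) (p q : PauliString n) :
    sign (C • p) (C • q) = sign p q := by
  obtain ⟨c, -, hc⟩ := (phaseEq_smul C p).symm
  obtain ⟨d, -, hd⟩ := (phaseEq_smul C q).symm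
  have h := pauli_mul_comm (C • p) (C • q)
  have h' : pauli (C • p) * pauli (C • q) =
      ((sign p q : ℤ) : ℂ) • (pauli (C • q) * pauli (C • p)) := by
    rw [hc, hd, smul_mul_smul_comm, smul_mul_smul_comm, ← unitary_conj_mul, ← unitary_conj_mul,
      pauli_mul_comm p q, mul_smul_comm, smul_mul_assoc, smul_comm, mul_comm c d]
  rw [h'] at h
  exact (Units.ext (Int.cast_injective
    (smul_left_injective ℂ (pauli_mul_ne_zero (C • q) (C • p)) h))).symm

theorem smul_eq_of_commute {C : cliffordGroup n} {p : PauliString n}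
    (h : Commute ((C : UnitaryOp n) : Op n) (pauli p)) : C • p = p := by
  have h' : ((C : UnitaryOp n) : Op n) * star ((C : UnitaryOp n) : Op n) = 1 :=
    Unitary.coe_mul_star_self _
  rw [smul_eq_iff, h.eq, mul_assoc, h', mul_one]
  exact .refl _

/-! ### Clifford transvections -/

/-- The operator `(1 + i σ_a) / √2`. -/
def transvectionOp (a : PauliString n) : Op n :=
  ((√2 : ℝ) : ℂ)⁻¹ • (1 + Complex.I • pauli a)

theorem star_transvectionOp (a : PauliString n) :
    star (transvectionOp a) = ((√2 : ℝ) : ℂ)⁻¹ • (1 - Complex.I • pauli a) := by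
  rw [transvectionOp, star_smul, star_add, star_one, star_smul, star_pauli]
  simp [sub_eq_add_neg]

theorem sqrt_two_inv_mul_self : ((√2 : ℝ) : ℂ)⁻¹ * ((√2 : ℝ) : ℂ)⁻¹ = 2⁻¹ := by
  rw [← mul_inv, ← Complex.ofReal_mul, Real.mul_self_sqrt (by norm_num)]
  simp

theorem transvectionOp_mul_star (a : PauliString n) :
    transvectionOp a * star (transvectionOp a) = 1 := by
  rw [star_transvectionOp, transvectionOp, smul_mul_smul_comm, sqrt_two_inv_mul_self]
  have : (1 + Complex.I • pauli a) * (1 - Complex.I • pauli a) = (2 : ℂ) • (1 : Op n) := by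
    rw [add_mul, mul_sub, mul_sub, smul_mul_smul_comm, pauli_mul_self, Complex.I_mul_I]
    simp only [one_mul, mul_one, neg_smul, one_smul, two_smul]
    abel
  rw [this, smul_smul]
  simp

theorem transvectionOp_mul_self (a : PauliString n) :
    transvectionOp a * transvectionOp a = Complex.I • pauli a := by
  rw [transvectionOp, smul_mul_smul_comm, sqrt_two_inv_mul_self]
  have : (1 + Complex.I • pauli a) * (1 + Complex.I • pauli a) =
      (2 : ℂ) • (Complex.I • pauli a) := by
    rw [add_mul, mul_add, mul_add, smul_mul_smul_comm, pauli_mul_self, Complex.I_mul_I]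
    simp only [one_mul, mul_one, neg_smul, one_smul, two_smul]
    abel
  rw [this, smul_smul]
  simp

/-- `transvectionOp` as a unitary. -/
def transvectionUnitary (a : PauliString n) : UnitaryOp n :=
  ⟨transvectionOp a, by rw [Matrix.mem_unitaryGroup_iff, transvectionOp_mul_star]⟩

theorem commute_transvectionOp {a p : PauliString n} (h : sign a p = 1) :
    Commute (transvectionOp a) (pauli p) := by
  have hc : Commute (pauli a) (pauli p) := by
    have := pauli_mul_comm a p
    rw [h] at this
    change pauli a * pauli p = pauli p * pauli a
    simpa using this
  exact ((Commute.one_left _).add_left (hc.smul_left _)).smul_left _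

/-- Moving σ_p across the adjoint flips the sign of σ_a and turns T† into T, so the conjugate is
T²σ_p, and T² = iσ_a. -/
theorem transvectionOp_conj_of_sign {a p : PauliString n} (h : sign a p = -1) :
    transvectionOp a * pauli p * star (transvectionOp a) = Complex.I • (pauli a * pauli p) := by
  have hc : pauli p * pauli a = -(pauli a * pauli p) := by
    have := pauli_mul_comm p a
    rw [sign_comm, h] at this
    simpa using this
  have : pauli p * star (transvectionOp a) = transvectionOp a * pauli p := by
    rw [star_transvectionOp, transvectionOp, mul_smul_comm, smul_mul_assoc, mul_sub, add_mul,
      mul_smul_comm, hc, smul_mul_assoc, smul_neg, sub_neg_eq_add, one_mul, mul_one]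
  rw [mul_assoc, this, ← mul_assoc, transvectionOp_mul_self, smul_mul_assoc]

theorem transvectionUnitary_conj_mem (a : PauliString n) {V : UnitaryOp n}
    (hV : V ∈ pauliGroup n) :
    transvectionUnitary a * V * (transvectionUnitary a)⁻¹ ∈ pauliGroup n := by
  obtain ⟨k, p, h⟩ := hV
  have e : ((transvectionUnitary a * V * (transvectionUnitary a)⁻¹ : UnitaryOp n) : Op n) =
      Complex.I ^ k • (transvectionOp a * pauli p * star (transvectionOp a)) := by
    change transvectionOp a * (V : Op n) * star (transvectionOp a) = _
    rw [h, mul_smul_comm, smul_mul_assoc]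
  rcases Int.units_eq_one_or (sign a p) with hs | hs
  · refine ⟨k, p, ?_⟩
    rw [e, (commute_transvectionOp hs).eq, mul_assoc, transvectionOp_mul_star, mul_one]
  · obtain ⟨l, hl⟩ := exists_pauli_mul_eq a p
    refine ⟨k + 1 + l, a * p, ?_⟩
    rw [e, transvectionOp_conj_of_sign hs, hl, smul_smul, smul_smul, pow_add, pow_add, pow_one,
      mul_assoc]

theorem transvectionUnitary_mem (a : PauliString n) : transvectionUnitary a ∈ cliffordGroup n := by
  refine Subgroup.mem_normalizer_iff.mpr fun V => ⟨transvectionUnitary_conj_mem a, fun h => ?_⟩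
  have h2 : transvectionUnitary a * transvectionUnitary a ∈ pauliGroup n :=
    ⟨1, a, by rw [pow_one]; exact transvectionOp_mul_self a⟩
  have h3 := transvectionUnitary_conj_mem a h
  -- Normalizing also needs the converse implication. As T² is itself a Pauli operator, conjugation
  -- by T⁻¹ is conjugation by T followed by conjugation by the Pauli operator T⁻².
  have e : V = (transvectionUnitary a * transvectionUnitary a)⁻¹ *
      (transvectionUnitary a * (transvectionUnitary a * V * (transvectionUnitary a)⁻¹) *
        (transvectionUnitary a)⁻¹) * (transvectionUnitary a * transvectionUnitary a) := by
    group
  rw [e]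
  exact mul_mem (mul_mem (inv_mem h2) h3) h2

/-- The Clifford unitary that acts on Pauli strings as the symplectic transvection along `a`. -/
def transvection (a : PauliString n) : cliffordGroup n :=
  ⟨transvectionUnitary a, transvectionUnitary_mem a⟩

theorem transvection_smul {a p : PauliString n} (h : sign a p = -1) :
    transvection a • p = a * p := by
  rw [smul_eq_iff]
  change PhaseEq (transvectionOp a * pauli p * star (transvectionOp a)) _
  rw [transvectionOp_conj_of_sign h]
  exact PhaseEq.trans ⟨Complex.I, by simp, rfl⟩ (phaseEq_pauli_mul a p)

/-! ### Transitivity -/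

/-- The Clifford unitaries that commute with the Pauli operators of a subgroup of strings. -/
def fixing (S : Subgroup (PauliString n)) : Set (cliffordGroup n) :=
  {C | ∀ s ∈ S, Commute ((C : UnitaryOp n) : Op n) (pauli s)}

theorem fixing_mul {S : Subgroup (PauliString n)} {C D : cliffordGroup n} (hC : C ∈ fixing S)
    (hD : D ∈ fixing S) : C * D ∈ fixing S := fun s hs => (hC s hs).mul_left (hD s hs)

theorem transvection_mem_fixing {S : Subgroup (PauliString n)} {a : PauliString n}
    (ha : a ∈ perp S) : transvection a ∈ fixing S :=
  fun s hs => commute_transvectionOp (ha s hs)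

/-- The transvection along u * v anticommutes with u, hence multiplies it by u * v and yields v. -/
theorem exists_fixing_smul_eq_of_sign {S : Subgroup (PauliString n)} {u v : PauliString n}
    (huv : u * v ∈ perp S) (h : sign u v = -1) : ∃ C ∈ fixing S, C • u = v := by
  refine ⟨transvection (u * v), transvection_mem_fixing huv, ?_⟩
  rw [transvection_smul, mul_right_comm, string_mul_self, one_mul]
  rw [sign_mul_left, sign_self, one_mul, sign_comm, h]

/-- If neither witness anticommutes with both strings, their product does. -/
theorem exists_common_sign {T : Subgroup (PauliString n)} {u v : PauliString n}
    (hu : ∃ t ∈ T, sign t u = -1) (hv : ∃ t ∈ T, sign t v = -1) :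
    ∃ t ∈ T, sign t u = -1 ∧ sign t v = -1 := by
  obtain ⟨a, ha, hau⟩ := hu
  obtain ⟨b, hb, hbv⟩ := hv
  rcases Int.units_eq_one_or (sign a v) with h1 | h1
  · rcases Int.units_eq_one_or (sign b u) with h2 | h2
    · refine ⟨a * b, mul_mem ha hb, ?_, ?_⟩
      · rw [sign_mul_left, hau, h2, mul_one]
      · rw [sign_mul_left, hbv, h1, one_mul]
    · exact ⟨b, hb, h2, hbv⟩
  · exact ⟨a, ha, hau, h1⟩

theorem exists_fixing_smul_eq {S : Subgroup (PauliString n)} {u v : PauliString n}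
    (hu : ∃ t ∈ perp S, sign t u = -1) (hv : ∃ t ∈ perp S, sign t v = -1)
    (huv : u * v ∈ perp S) : ∃ C ∈ fixing S, C • u = v := by
  rcases Int.units_eq_one_or (sign u v) with h | h
  · obtain ⟨t, ht, htu, htv⟩ := exists_common_sign hu hv
    -- Since u and v commute, no single transvection of this kind joins them. The detour through u *
    -- t, with t in `perp S` anticommuting with both, makes each half anticommute.
    obtain ⟨C, hC, hCu⟩ := exists_fixing_smul_eq_of_sign (S := S) (u := u) (v := u * t)
      (by rwa [← mul_assoc, string_mul_self, one_mul])
      (by rw [sign_mul_right, sign_self, one_mul, sign_comm, htu])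
    obtain ⟨D, hD, hDu⟩ := exists_fixing_smul_eq_of_sign (S := S) (u := u * t) (v := v)
      (by rw [mul_right_comm]; exact mul_mem huv ht)
      (by rw [sign_mul_left, h, htv, one_mul])
    exact ⟨D * C, fixing_mul hD hC, by rw [mul_smul, hCu, hDu]⟩
  · exact exists_fixing_smul_eq_of_sign huv h

/-! ### The standard subgroups -/

/-- The subgroup `{I, Z}` of the single-qubit Pauli letters. -/
def zLetters : Subgroup Letter where
  carrier := {a | a = .I ∨ a = .Z}
  one_mem' := Or.inl rfl
  mul_mem' {a b} := by revert a b; simp only [Set.mem_ofPred_eq]; decide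
  inv_mem' {_} h := h

theorem mem_zLetters {a : Letter} : a ∈ zLetters ↔ a = .I ∨ a = .Z := Iff.rfl

/-- The strings of `{I, X, Y, Z}^{⊗ k} ⊗ {I, Z}^{⊗ l} ⊗ {I}^{⊗ (n - k - l)}`. -/
def std (n k l : ℕ) : Subgroup (PauliString n) where
  carrier := {p | ∀ i : Fin n, (k ≤ i → p i ∈ zLetters) ∧ (k + l ≤ i → p i = 1)}
  one_mem' _ := ⟨fun _ => one_mem _, fun _ => rfl⟩
  mul_mem' hp hq i := ⟨fun h => mul_mem ((hp i).1 h) ((hq i).1 h),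
    fun h => by rw [Pi.mul_apply, (hp i).2 h, (hq i).2 h, one_mul]⟩
  inv_mem' hp := hp

theorem mem_std {k l : ℕ} {p : PauliString n} : p ∈ std n k l ↔
    ∀ i : Fin n, (k ≤ i → p i ∈ zLetters) ∧ (k + l ≤ i → p i = 1) := Iff.rfl

theorem Letter.eq_one_of_sign : ∀ a : Letter, Letter.sign .X a = 1 → Letter.sign .Z a = 1 →
    a = 1 := by decide

theorem Letter.sign_Z_eq_one_iff : ∀ a : Letter, Letter.sign .Z a = 1 ↔ a = .I ∨ a = .Z := by
  decide

theorem Letter.sign_of_mem : ∀ a b : Letter, (a = .I ∨ a = .Z) → (b = .I ∨ b = .Z) →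
    a.sign b = 1 := by decide

theorem mulSingle_mem_std_zero {k l : ℕ} {i : Fin n} (hi : (i : ℕ) < k) (a : Letter) :
    Pi.mulSingle i a ∈ std n k l := by
  intro j
  by_cases h : j = i
  · subst h
    exact ⟨fun _ => by omega, fun _ => by omega⟩
  · rw [Pi.mulSingle_eq_of_ne h]
    exact ⟨fun _ => one_mem _, fun _ => rfl⟩

theorem mulSingle_mem_std {k l : ℕ} {i : Fin n} (hi : (i : ℕ) < k + l) {a : Letter}
    (ha : a ∈ zLetters) : Pi.mulSingle i a ∈ std n k l := by
  intro j
  by_cases h : j = i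
  · subst h
    exact ⟨fun _ => by rwa [Pi.mulSingle_eq_same], fun _ => by omega⟩
  · rw [Pi.mulSingle_eq_of_ne h]
    exact ⟨fun _ => one_mem _, fun _ => rfl⟩

theorem mem_perp_std {k l : ℕ} {p : PauliString n} : p ∈ perp (std n k l) ↔
    ∀ i : Fin n, ((i : ℕ) < k → p i = 1) ∧ ((i : ℕ) < k + l → p i ∈ zLetters) := by
  constructor
  · intro h i
    refine ⟨fun hi => ?_, fun hi => ?_⟩
    · refine Letter.eq_one_of_sign _ ?_ ?_ <;> rw [← sign_mulSingle, sign_comm] <;>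
        exact h _ (mulSingle_mem_std_zero hi _)
    · rw [mem_zLetters, ← Letter.sign_Z_eq_one_iff, ← sign_mulSingle, sign_comm]
      exact h _ (mulSingle_mem_std hi (Or.inr rfl))
  · intro h s hs
    refine Finset.prod_eq_one fun i _ => ?_
    by_cases h1 : (i : ℕ) < k
    · rw [(h i).1 h1]
      simp [Letter.sign]
    · by_cases h2 : (i : ℕ) < k + l
      · exact Letter.sign_of_mem _ _ ((h i).2 h2) ((hs i).1 (by omega))
      · rw [(hs i).2 (by omega)]
        simp [Letter.sign]

/-- This is the nontrivial half of `perp (perp S) = S` for standard S. A letter X or Y beyond the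
first block is detected by a single Z, and a letter Z in the third block by a single X. -/
theorem exists_sign_of_not_mem_std {k l : ℕ} {u : PauliString n} (hu : u ∉ std n k l) :
    ∃ t ∈ perp (std n k l), sign t u = -1 := by
  have hZ : ∀ i : Fin n, k ≤ (i : ℕ) → u i ∉ zLetters →
      ∃ t ∈ perp (std n k l), sign t u = -1 := by
    intro i hi hui
    refine ⟨Pi.mulSingle i .Z, mem_perp_std.mpr fun j => ?_, ?_⟩
    · by_cases h : j = i
      · subst h
        exact ⟨fun _ => by omega, fun _ => by rw [Pi.mulSingle_eq_same]; exact Or.inr rfl⟩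
      · rw [Pi.mulSingle_eq_of_ne h]
        exact ⟨fun _ => rfl, fun _ => one_mem _⟩
    · rw [sign_mulSingle]
      refine (Int.units_eq_one_or _).resolve_left fun h => hui ?_
      exact (Letter.sign_Z_eq_one_iff _).mp h
  rw [mem_std, not_forall] at hu
  obtain ⟨i, hi⟩ := hu
  by_cases h1 : k ≤ (i : ℕ) ∧ u i ∉ zLetters
  · exact hZ i h1.1 h1.2
  · have h2 : k + l ≤ (i : ℕ) ∧ u i ≠ 1 := by
      by_contra h2
      refine hi ⟨fun h => ?_, fun h => ?_⟩
      · by_contra h'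
        exact h1 ⟨h, h'⟩
      · by_contra h'
        exact h2 ⟨h, h'⟩
    have hz : u i ∈ zLetters := by
      by_contra h'
      exact h1 ⟨by omega, h'⟩
    refine ⟨Pi.mulSingle i .X, mem_perp_std.mpr fun j => ?_, ?_⟩
    · by_cases h : j = i
      · subst h
        exact ⟨fun _ => by omega, fun _ => by omega⟩
      · rw [Pi.mulSingle_eq_of_ne h]
        exact ⟨fun _ => rfl, fun _ => one_mem _⟩
    · rw [sign_mulSingle]
      have : u i = .Z := (mem_zLetters.mp hz).resolve_left h2.2
      rw [this]
      rfl

theorem update_mul_mulSingle (p : PauliString n) (i : Fin n) :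
    Function.update p i 1 * Pi.mulSingle i (p i) = p := by
  ext j
  by_cases h : j = i
  · subst h
    simp
  · simp [h]

theorem update_mem_std_of_succ {k l : ℕ} {p : PauliString n} (i : Fin n) (hi : (i : ℕ) = k + l)
    (hp : p ∈ std n k (l + 1)) : Function.update p i 1 ∈ std n k l := by
  intro j
  by_cases h : j = i
  · subst h
    rw [Function.update_self]
    exact ⟨fun _ => one_mem _, fun _ => rfl⟩
  · rw [Function.update_of_ne h]
    refine ⟨(hp j).1, fun hj => (hp j).2 ?_⟩
    have : (j : ℕ) ≠ i := fun h' => h (Fin.ext h')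
    omega

theorem std_succ_le {k l : ℕ} {S : Subgroup (PauliString n)} (h : std n k l ≤ S) (i : Fin n)
    (hi : (i : ℕ) = k + l) (hz : Pi.mulSingle i .Z ∈ S) : std n k (l + 1) ≤ S := by
  intro p hp
  rw [← update_mul_mulSingle p i]
  refine mul_mem (h (update_mem_std_of_succ i hi hp)) ?_
  rcases mem_zLetters.mp ((hp i).1 (by omega)) with h1 | h1
  · rw [h1]
    change Pi.mulSingle i (1 : Letter) ∈ S
    rw [Pi.mulSingle_one]
    exact one_mem _
  · rwa [h1]

theorem std_succ_zero_le {k : ℕ} {S : Subgroup (PauliString n)} (h : std n k 0 ≤ S) (i : Fin n)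
    (hi : (i : ℕ) = k) (hz : Pi.mulSingle i .Z ∈ S) (hx : Pi.mulSingle i .X ∈ S) :
    std n (k + 1) 0 ≤ S := by
  intro p hp
  rw [← update_mul_mulSingle p i]
  refine mul_mem (h fun j => ?_) ?_
  · by_cases h : j = i
    · subst h
      rw [Function.update_self]
      exact ⟨fun _ => one_mem _, fun _ => rfl⟩
    · rw [Function.update_of_ne h]
      have : (j : ℕ) ≠ i := fun h' => h (Fin.ext h')
      exact ⟨fun hj => (hp j).1 (by omega), fun hj => (hp j).2 (by omega)⟩
  · cases p i
    · change Pi.mulSingle i (1 : Letter) ∈ S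
      rw [Pi.mulSingle_one]
      exact one_mem _
    · exact hx
    · have : (Letter.Y : Letter) = .X * .Z := rfl
      rw [this, Pi.mulSingle_mul]
      exact mul_mem hx hz
    · exact hz

/-! ### Bringing a subgroup to standard form -/

/-- The preimage of a subgroup of strings under a Clifford unitary. -/
def preimage (C : cliffordGroup n) (S : Subgroup (PauliString n)) : Subgroup (PauliString n) :=
  S.comap (MulDistribMulAction.toMonoidHom (PauliString n) C)

theorem mem_preimage {C : cliffordGroup n} {S : Subgroup (PauliString n)} {p : PauliString n} :
    p ∈ preimage C S ↔ C • p ∈ S := Iff.rfl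

theorem smul_of_mem_fixing {S : Subgroup (PauliString n)} {C : cliffordGroup n}
    (hC : C ∈ fixing S) {s : PauliString n} (hs : s ∈ S) : C • s = s :=
  smul_eq_of_commute (hC s hs)

theorem inv_smul_of_mem_fixing {S : Subgroup (PauliString n)} {C : cliffordGroup n}
    (hC : C ∈ fixing S) {s : PauliString n} (hs : s ∈ S) : C⁻¹ • s = s :=
  inv_smul_eq_iff.mpr (smul_of_mem_fixing hC hs).symm

theorem sign_smul_of_mem_fixing {S : Subgroup (PauliString n)} {C : cliffordGroup n}
    (hC : C ∈ fixing S) (p : PauliString n) {s : PauliString n} (hs : s ∈ S) :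
    sign (C • p) s = sign p s := by
  conv_lhs => rw [← smul_of_mem_fixing hC hs, sign_smul_smul]

theorem smul_mem_perp {S : Subgroup (PauliString n)} {C : cliffordGroup n}
    (hC : C ∈ fixing S) {p : PauliString n} (hp : p ∈ perp S) : C • p ∈ perp S :=
  fun s hs => by rw [sign_smul_of_mem_fixing hC p hs, hp s hs]

theorem mulSingle_mem_perp_std {k l : ℕ} {i : Fin n} (hi : k + l ≤ (i : ℕ)) (a : Letter) :
    Pi.mulSingle i a ∈ perp (std n k l) := by
  refine mem_perp_std.mpr fun j => ?_
  by_cases h : j = i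
  · subst h
    exact ⟨fun _ => by omega, fun _ => by omega⟩
  · rw [Pi.mulSingle_eq_of_ne h]
    exact ⟨fun _ => rfl, fun _ => one_mem _⟩

/-- The commutation sign with a fixed string, as a homomorphism. -/
def signHom (p : PauliString n) : PauliString n →* ℤˣ where
  toFun := sign p
  map_one' := sign_one_right p
  map_mul' := sign_mul_right p

/-- An anticommuting pair a, b outside the first k qubits becomes the pair Z, X on the next qubit: a
is moved to Z first, then b to X by a Clifford unitary that also fixes this Z. -/
theorem exists_std_succ_zero_le {k : ℕ} {S : Subgroup (PauliString n)} (h : std n k 0 ≤ S)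
    {a b : PauliString n} (ha : a ∈ S) (ha' : a ∈ perp (std n k 0)) (hb : b ∈ S)
    (hb' : b ∈ perp (std n k 0)) (hab : sign a b = -1) :
    k + 1 ≤ n ∧ ∃ D : cliffordGroup n, std n (k + 1) 0 ≤ preimage D⁻¹ S := by
  have hk : k < n := by
    by_contra hk
    have : a = 1 := funext fun i => (mem_perp_std.mp ha' i).1 (by omega)
    rw [this, sign_one_left] at hab
    exact absurd hab (by decide)
  refine ⟨hk, ?_⟩
  let i : Fin n := ⟨k, hk⟩
  have hz : ∀ c, Pi.mulSingle i c ∈ perp (std n k 0) := mulSingle_mem_perp_std (by simp [i])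
  obtain ⟨D, hD, hDa⟩ := exists_fixing_smul_eq (S := std n k 0) (u := a) (v := Pi.mulSingle i .Z)
    ⟨b, hb', by rw [sign_comm, hab]⟩
    ⟨Pi.mulSingle i .X, hz _, by rw [sign_mulSingle, Pi.mulSingle_eq_same]; rfl⟩
    (mul_mem ha' (hz _))
  have hzz : Pi.mulSingle i .Z ∈ std n k 1 := mulSingle_mem_std (by simp [i]) (Or.inr rfl)
  have hzp : Pi.mulSingle i .Z ∈ perp (std n k 1) := by
    refine mem_perp_std.mpr fun j => ?_
    by_cases hj : j = i
    · subst hj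
      exact ⟨fun h => by simp [i] at h, fun _ => by rw [Pi.mulSingle_eq_same]; exact Or.inr rfl⟩
    · rw [Pi.mulSingle_eq_of_ne hj]
      exact ⟨fun _ => rfl, fun _ => one_mem _⟩
  have hzb : sign (Pi.mulSingle i .Z) (D • b) = -1 := by rw [← hDa, sign_smul_smul, hab]
  have hzx : sign (Pi.mulSingle i .Z) (Pi.mulSingle i .X : PauliString n) = -1 := by
    rw [sign_mulSingle, Pi.mulSingle_eq_same]; rfl
  -- The moved b and X have the same sign against Z, so their product commutes with Z too; this
  -- permits a second move fixing the larger group `std n k 1`.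
  have hbx : D • b * Pi.mulSingle i .X ∈ perp (std n k 1) := by
    have hle : std n k 1 ≤ (signHom (D • b * Pi.mulSingle i .X)).ker := by
      refine std_succ_le (fun s hs => ?_) i rfl ?_
      · exact mul_mem (smul_mem_perp hD hb') (hz _) s hs
      · change sign _ _ = 1
        rw [sign_comm, sign_mul_right, hzb, hzx]
        rfl
    exact fun s hs => hle hs
  obtain ⟨E, hE, hEb⟩ := exists_fixing_smul_eq (S := std n k 1) (u := D • b)
    (v := Pi.mulSingle i .X) ⟨_, hzp, hzb⟩ ⟨_, hzp, hzx⟩ hbx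
  refine ⟨E * D, std_succ_zero_le (fun p hp => ?_) i rfl ?_ ?_⟩
  · have hp' : p ∈ std n k 1 := fun j => ⟨(hp j).1, fun hj => (hp j).2 (by omega)⟩
    rw [mem_preimage, mul_inv_rev, mul_smul, inv_smul_of_mem_fixing hE hp',
      inv_smul_of_mem_fixing hD hp]
    exact h hp
  · rw [mem_preimage, mul_inv_rev, mul_smul, inv_smul_of_mem_fixing hE hzz, ← hDa, inv_smul_smul]
    exact ha
  · rw [mem_preimage, mul_inv_rev, mul_smul, ← hEb, inv_smul_smul, inv_smul_smul]
    exact hb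

theorem exists_std_succ_le {k l : ℕ} {S : Subgroup (PauliString n)} (h : std n k l ≤ S)
    {c : PauliString n} (hc : c ∈ S) (hc' : c ∈ perp (std n k l)) (hc'' : c ∉ std n k l) :
    k + (l + 1) ≤ n ∧ ∃ D : cliffordGroup n, std n k (l + 1) ≤ preimage D⁻¹ S := by
  have hk : k + l < n := by
    by_contra hk
    refine hc'' fun i => ⟨fun _ => (mem_perp_std.mp hc' i).2 (by omega), fun _ => by omega⟩
  refine ⟨hk, ?_⟩
  let i : Fin n := ⟨k + l, hk⟩
  have hz : ∀ c, Pi.mulSingle i c ∈ perp (std n k l) := mulSingle_mem_perp_std (by simp [i])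
  obtain ⟨D, hD, hDc⟩ := exists_fixing_smul_eq (S := std n k l) (u := c) (v := Pi.mulSingle i .Z)
    (exists_sign_of_not_mem_std hc'')
    ⟨Pi.mulSingle i .X, hz _, by rw [sign_mulSingle, Pi.mulSingle_eq_same]; rfl⟩
    (mul_mem hc' (hz _))
  refine ⟨D, std_succ_le (fun p hp => ?_) i rfl ?_⟩
  · rw [mem_preimage, inv_smul_of_mem_fixing hD hp]
    exact h hp
  · rw [mem_preimage, ← hDc, inv_smul_smul]
    exact hc

theorem preimage_preimage (C D : cliffordGroup n) (S : Subgroup (PauliString n)) :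
    preimage D⁻¹ (preimage C⁻¹ S) = preimage (D * C)⁻¹ S := by
  ext p
  rw [mem_preimage, mem_preimage, mem_preimage, mul_inv_rev, mul_smul]

/-- The part of a string outside the first `k` qubits. -/
def tail (k : ℕ) (p : PauliString n) : PauliString n := fun i => if (i : ℕ) < k then 1 else p i

theorem mul_tail_mem_std (k : ℕ) (p : PauliString n) : p * tail k p ∈ std n k 0 := by
  intro i
  have : k ≤ (i : ℕ) → (p * tail k p) i = 1 := fun hi => by
    rw [Pi.mul_apply, tail, if_neg (by omega), Letter.mul_self]
  exact ⟨fun hi => this hi ▸ one_mem _, this⟩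

theorem mul_tail_mul_tail (k : ℕ) (p : PauliString n) : p * tail k p * tail k p = p := by
  rw [mul_assoc, string_mul_self, mul_one]

theorem tail_mem_perp_std (k : ℕ) (p : PauliString n) : tail k p ∈ perp (std n k 0) := by
  refine mem_perp_std.mpr fun i => ?_
  have : (i : ℕ) < k → tail k p i = 1 := fun hi => if_pos hi
  exact ⟨this, fun hi => this hi ▸ one_mem _⟩

theorem tail_mem {k : ℕ} {S : Subgroup (PauliString n)} (hS : std n k 0 ≤ S) {p : PauliString n}
    (hp : p ∈ S) : tail k p ∈ S := by
  have := mul_mem hp (hS (mul_tail_mem_std k p))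
  rwa [← mul_assoc, string_mul_self, one_mul] at this

/-- Every subgroup of Pauli strings is brought to standard form by a Clifford unitary. -/
theorem exists_preimage_eq_std (S : Subgroup (PauliString n)) :
    ∃ k l, k + l ≤ n ∧ ∃ C : cliffordGroup n, preimage C⁻¹ S = std n k l := by
  classical
  let A : ℕ → Prop := fun k => k ≤ n ∧ ∃ C : cliffordGroup n, std n k 0 ≤ preimage C⁻¹ S
  have hA : A 0 := ⟨Nat.zero_le _, 1, fun p hp => by
    have : p = 1 := funext fun i => (hp i).2 (Nat.zero_le _)
    rw [this]
    exact one_mem _⟩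
  -- Such a k exists because `A` contains the bound k ≤ n. Failure of `A (k + 1)` is for all
  -- Clifford unitaries at once, so it stays usable after C is replaced below.
  obtain ⟨k, ⟨hk, C, hC⟩, hkmax⟩ : ∃ k, A k ∧ ¬ A (k + 1) := by
    by_contra! hne
    have : ∀ k, A k := fun k => Nat.rec hA (fun k hk => hne k hk) k
    have := (this (n + 1)).1
    omega
  let B : ℕ → Prop := fun l => k + l ≤ n ∧ ∃ C : cliffordGroup n, std n k l ≤ preimage C⁻¹ S
  have hB : B 0 := ⟨hk, C, hC⟩
  obtain ⟨l, ⟨hl, C, hC⟩, hlmax⟩ : ∃ l, B l ∧ ¬ B (l + 1) := by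
    by_contra! hne
    have : ∀ l, B l := fun l => Nat.rec hB (fun l hl => hne l hl) l
    have := (this (n + 1)).1
    omega
  refine ⟨k, l, hl, C, le_antisymm (fun p hp => ?_) hC⟩
  have hkl : std n k 0 ≤ std n k l := fun q hq i =>
    ⟨(hq i).1, fun hi => (hq i).2 (by omega)⟩
  -- An anticommuting pair here would extend the first block, so what lies outside it is isotropic.
  have hiso : ∀ a ∈ preimage C⁻¹ S, a ∈ perp (std n k 0) → ∀ b ∈ preimage C⁻¹ S,
      b ∈ perp (std n k 0) → sign a b = 1 := by
    intro a ha ha' b hb hb'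
    refine (Int.units_eq_one_or _).resolve_right fun hab => hkmax ?_
    obtain ⟨h1, D, hD⟩ := exists_std_succ_zero_le (hkl.trans hC) ha ha' hb hb' hab
    exact ⟨h1, D * C, by rwa [← preimage_preimage]⟩
  rw [← mul_tail_mul_tail k p]
  refine mul_mem (hkl (mul_tail_mem_std k p)) ?_
  have ht := tail_mem (hkl.trans hC) hp
  by_contra hnot
  refine hlmax ?_
  have htp : tail k p ∈ perp (std n k l) := fun s hs => by
    rw [← mul_tail_mul_tail k s, sign_mul_right, tail_mem_perp_std k p _ (mul_tail_mem_std k s),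
      one_mul]
    exact hiso _ ht (tail_mem_perp_std k p) _ (tail_mem (hkl.trans hC) (hC hs))
      (tail_mem_perp_std k s)
  obtain ⟨h1, D, hD⟩ := exists_std_succ_le hC ht htp hnot
  exact ⟨h1, D * C, by rwa [← preimage_preimage]⟩

/-! ### Averages over orbits -/

/-- Each fibre of a ↦ a • x over the orbit is a coset of the stabilizer, so all points of the orbit
carry equal weight. -/
theorem average_smul_eq {G α ι V : Type*} [Group G] [Fintype G] [MulAction G α] [AddCommGroup V]
    [Module ℂ V] (x : α) (T : Finset ι) (g : ι → α) (hg : Set.InjOn g T)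
    (hT : ∀ y, (∃ t ∈ T, g t = y) ↔ y ∈ MulAction.orbit G x) (f : α → V) :
    average (Finset.univ : Finset G) (fun a => f (a • x)) = average T fun t => f (g t) := by
  classical
  have hfib : ∀ t ∈ T, (Finset.univ.filter fun a : G => a • x = g t).card =
      (Finset.univ.filter fun a : G => a • x = x).card := by
    intro t ht
    obtain ⟨b, hb⟩ := (hT (g t)).mp ⟨t, ht, rfl⟩
    replace hb : b • x = g t := hb
    refine Finset.card_nbij' (b⁻¹ * ·) (b * ·) ?_ ?_ ?_ ?_ <;> intro a ha
    · have ha' : a • x = g t := by simpa using ha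
      simp [mul_smul, ha', ← hb]
    · have ha' : a • x = x := by simpa using ha
      simp [mul_smul, ha', hb]
    · exact mul_inv_cancel_left b a
    · exact inv_mul_cancel_left b a
  have hmaps : ∀ a ∈ (Finset.univ : Finset G), a • x ∈ T.image g := fun a _ =>
    Finset.mem_image.mpr ((hT _).mpr ⟨a, rfl⟩)
  have hcard : Fintype.card G = T.card * (Finset.univ.filter fun a : G => a • x = x).card := by
    rw [← Finset.card_univ, Finset.card_eq_sum_card_fiberwise hmaps, Finset.sum_image hg,
      Finset.sum_congr rfl hfib, Finset.sum_const, smul_eq_mul]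
  have hsum : ∑ a : G, f (a • x) =
      ((Finset.univ.filter fun a : G => a • x = x).card : ℂ) • ∑ t ∈ T, f (g t) := by
    rw [← Finset.sum_fiberwise_of_maps_to hmaps, Finset.sum_image hg, Finset.smul_sum]
    refine Finset.sum_congr rfl fun t ht => ?_
    rw [← hfib t ht, Nat.cast_smul_eq_nsmul, ← Finset.sum_const]
    exact Finset.sum_congr rfl fun a ha => by rw [(Finset.mem_filter.mp ha).2]
  have h0 : ((Finset.univ.filter fun a : G => a • x = x).card : ℂ) ≠ 0 :=
    Nat.cast_ne_zero.mpr (Finset.card_ne_zero.mpr ⟨1, by simp⟩)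
  rw [average, average, hsum, Finset.card_univ, hcard, smul_smul, Nat.cast_mul, mul_inv, mul_assoc,
    inv_mul_cancel₀ h0, mul_one]

/-! ### The twirl of a Pauli channel as an average over an orbit of strings -/

/-- `unitaryChannel` as a homomorphism. -/
def channelHom (n : ℕ) : UnitaryOp n →* (Op n ≃ₗ[ℂ] Op n) where
  toFun := unitaryChannel
  map_one' := by
    ext1 A
    change (1 : Op n) * A * star (1 : Op n) = A
    simp
  map_mul' C D := by
    ext1 A
    change ((C : Op n) * (D : Op n)) * A * star ((C : Op n) * (D : Op n)) =
      (C : Op n) * ((D : Op n) * A * star (D : Op n)) * star (C : Op n)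
    rw [star_mul]
    simp only [mul_assoc]

/-- Conjugation of linear maps on operators by invertible ones. -/
@[reducible]
def conjAction (n : ℕ) : MulAction (Op n ≃ₗ[ℂ] Op n) (Op n →ₗ[ℂ] Op n) where
  smul D N := D.toLinearMap ∘ₗ N ∘ₗ D.symm.toLinearMap
  one_smul _ := rfl
  mul_smul _ _ _ := rfl

theorem unitaryChannel_conj (C : cliffordGroup n) (p : PauliString n) :
    (unitaryChannel (C : UnitaryOp n)).toLinearMap ∘ₗ conjChannel (pauli p) ∘ₗ
      (unitaryChannel (C : UnitaryOp n)).symm.toLinearMap = conjChannel (pauli (C • p)) := by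
  rw [← (phaseEq_smul C p).conjChannel_eq]
  ext1 A
  change ((C : UnitaryOp n) : Op n) * (pauli p * (star ((C : UnitaryOp n) : Op n) * A *
    ((C : UnitaryOp n) : Op n)) * star (pauli p)) * star ((C : UnitaryOp n) : Op n) =
    ((C : UnitaryOp n) : Op n) * pauli p * star ((C : UnitaryOp n) : Op n) * A *
      star (((C : UnitaryOp n) : Op n) * pauli p * star ((C : UnitaryOp n) : Op n))
  simp only [star_mul, star_star, mul_assoc]

/-- The pair T, g enumerates the orbit without repetition. The averaging group is the image in the
linear automorphisms of operators, where phases vanish and the group is finite. Reindexing by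
inversion turns D† ∘ 𝒩 ∘ D into the action D ∘ 𝒩 ∘ D†. -/
theorem twirl_eq_average {ι : Type*} (Q : Subgroup (UnitaryOp n)) (p : PauliString n)
    (T : Finset ι) (g : ι → PauliString n) (hg : Set.InjOn g T)
    (hT : ∀ q, (∃ t ∈ T, g t = q) ↔
      ∃ C : cliffordGroup n, (C : UnitaryOp n) ∈ symmetricCliffordGroup Q ∧ C • p = q) :
    twirl Q (conjChannel (pauli p)) = average T fun t => conjChannel (pauli (g t)) := by
  let H : Subgroup (Op n ≃ₗ[ℂ] Op n) := (symmetricCliffordGroup Q).map (channelHom n)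
  let := conjAction n
  have : Finite H := finite_symmetricCliffordChannels Q
  let : Fintype H := Fintype.ofFinite H
  have h := average_smul_eq (G := H) (conjChannel (pauli p)) T (fun t => conjChannel (pauli (g t)))
    (fun s hs t ht hst => hg hs ht (conjChannel_pauli_injective hst)) (fun N => ?_) id
  · refine Eq.trans ?_ h
    have hmem : ∀ D, D ∈ (finite_symmetricCliffordChannels Q).toFinset ↔ D ∈ H := fun D => by
      rw [Set.Finite.mem_toFinset]; rfl
    rw [twirl, average, average, Finset.sum_subtype _ hmem, Finset.card_univ,
      ← Fintype.card_of_subtype _ hmem, ← Equiv.sum_comp (Equiv.inv H)]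
    rfl
  · constructor
    · rintro ⟨t, ht, rfl⟩
      obtain ⟨C, hC, hCp⟩ := (hT (g t)).mp ⟨t, ht, rfl⟩
      refine ⟨⟨unitaryChannel (C : UnitaryOp n), ⟨_, hC, rfl⟩⟩, ?_⟩
      rw [← hCp, ← unitaryChannel_conj]
      rfl
    · rintro ⟨⟨_, C, hC, rfl⟩, rfl⟩
      obtain ⟨t, ht, htq⟩ := (hT ((⟨C, hC.1⟩ : cliffordGroup n) • p)).mpr ⟨⟨C, hC.1⟩, hC, rfl⟩
      refine ⟨t, ht, ?_⟩
      rw [htq, ← unitaryChannel_conj]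
      rfl

/-! ### Orbits of the symmetric Clifford group on strings -/

/-- The Pauli strings of a group of unitaries, up to phases. -/
def labels (Q : Subgroup (UnitaryOp n)) : Subgroup (PauliString n) where
  carrier := {p | ∃ R ∈ Q, PhaseEq (pauli p) (R : Op n)}
  one_mem' := ⟨1, one_mem _, by
    have h1 : pauli (1 : PauliString n) = 1 := pauli_idString n
    rw [h1]
    exact .refl _⟩
  mul_mem' := by
    rintro p q ⟨R, hR, hp⟩ ⟨R', hR', hq⟩
    exact ⟨R * R', mul_mem hR hR', (phaseEq_pauli_mul p q).symm.trans (hp.mul hq)⟩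
  inv_mem' h := h

theorem mem_labels {Q : Subgroup (UnitaryOp n)} {p : PauliString n} :
    p ∈ labels Q ↔ ∃ R ∈ Q, PhaseEq (pauli p) (R : Op n) := Iff.rfl

theorem symmetryGroup_le (U : UnitaryOp n) : symmetryGroup U ≤ pauliGroup n := by
  refine (Subgroup.closure_le _).mpr ?_
  rintro _ ⟨p, -, rfl⟩
  exact pauliUnitary_mem p

theorem commute_of_phaseEq {A B C : Op n} (h : PhaseEq A B) (hB : Commute C B) : Commute C A := by
  obtain ⟨c, -, rfl⟩ := h
  exact hB.smul_right c

theorem mem_symmetricCliffordGroup_iff {Q : Subgroup (UnitaryOp n)} (hQ : Q ≤ pauliGroup n)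
    (C : cliffordGroup n) :
    (C : UnitaryOp n) ∈ symmetricCliffordGroup Q ↔ C ∈ fixing (labels Q) := by
  constructor
  · rintro ⟨-, hC⟩ s ⟨R, hR, hs⟩
    exact commute_of_phaseEq hs (congrArg Subtype.val (Subgroup.mem_centralizer_iff.mp hC R hR)).symm
  · refine fun hC => ⟨C.2, Subgroup.mem_centralizer_iff.mpr fun R hR => ?_⟩
    obtain ⟨p, hp⟩ := exists_string_of_mem_pauliGroup (hQ hR)
    exact Subtype.ext (commute_of_phaseEq hp (hC p ⟨R, hR, hp.symm⟩)).eq.symm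

theorem exists_fixing_smul_eq_iff {S : Subgroup (PauliString n)}
    (hS : ∀ u ∉ S, ∃ t ∈ perp S, sign t u = -1) {p : PauliString n} (hp : p ∉ S)
    (q : PauliString n) : (∃ C ∈ fixing S, C • p = q) ↔ q ∉ S ∧ p * q ∈ perp S := by
  constructor
  · rintro ⟨C, hC, rfl⟩
    refine ⟨fun h => hp ?_, fun s hs => ?_⟩
    · have := inv_smul_of_mem_fixing hC h
      rw [inv_smul_smul] at this
      rwa [this]
    · rw [sign_mul_left, sign_smul_of_mem_fixing hC p hs, Int.units_mul_self]
  · rintro ⟨hq, h⟩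
    exact exists_fixing_smul_eq (hS p hp) (hS q hq) h

theorem mem_perp_preimage_iff (W : cliffordGroup n) (S : Subgroup (PauliString n))
    (p : PauliString n) : p ∈ perp (preimage W S) ↔ W • p ∈ perp S := by
  constructor
  · intro h s hs
    have := h (W⁻¹ • s) (by rwa [mem_preimage, smul_inv_smul])
    rwa [← sign_smul_smul W, smul_inv_smul] at this
  · intro h s hs
    rw [← sign_smul_smul W]
    exact h _ hs

theorem exists_sign_of_not_mem_preimage_std (W : cliffordGroup n) {k l : ℕ} {u : PauliString n}
    (hu : u ∉ preimage W (std n k l)) : ∃ t ∈ perp (preimage W (std n k l)), sign t u = -1 := by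
  obtain ⟨t, ht, h⟩ := exists_sign_of_not_mem_std (u := W • u) hu
  refine ⟨W⁻¹ • t, (mem_perp_preimage_iff W _ _).mpr (by rwa [smul_inv_smul]), ?_⟩
  rwa [← sign_smul_smul W, smul_inv_smul]

/-! ### Strings on three blocks of qubits -/

variable {n₁ n₂ n₃ : ℕ}

/-- The concatenation of three strings. -/
def join (h : n₁ + n₂ + n₃ = n) (a : PauliString n₁) (b : PauliString n₂) (c : PauliString n₃) :
    PauliString n := fun i => Fin.append (Fin.append a b) c (Fin.cast h.symm i)

theorem tensor_pauli (h : n₁ + n₂ + n₃ = n) (a : PauliString n₁) (b : PauliString n₂)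
    (c : PauliString n₃) : tensor h (pauli a) (pauli b) (pauli c) = pauli (join h a b c) := by
  subst h
  ext x y
  simp [tensor, pauli, join, Fin.prod_univ_add]

theorem exists_join (h : n₁ + n₂ + n₃ = n) (p : PauliString n) :
    ∃ a b c, p = join h a b c := by
  subst h
  refine ⟨fun i => p (Fin.castAdd n₃ (Fin.castAdd n₂ i)),
    fun i => p (Fin.castAdd n₃ (Fin.natAdd n₁ i)), fun i => p (Fin.natAdd (n₁ + n₂) i), ?_⟩
  ext i
  refine Fin.addCases (fun j => Fin.addCases (fun k => ?_) (fun k => ?_) j) (fun j => ?_) i <;>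
    simp [join]

theorem join_mul_join (h : n₁ + n₂ + n₃ = n) (a a' : PauliString n₁) (b b' : PauliString n₂)
    (c c' : PauliString n₃) :
    join h a b c * join h a' b' c' = join h (a * a') (b * b') (c * c') := by
  subst h
  ext i
  refine Fin.addCases (fun j => Fin.addCases (fun k => ?_) (fun k => ?_) j) (fun j => ?_) i <;>
    simp [join]

theorem join_inj (h : n₁ + n₂ + n₃ = n) {a a' : PauliString n₁} {b b' : PauliString n₂}
    {c c' : PauliString n₃} (e : join h a b c = join h a' b' c') : a = a' ∧ b = b' ∧ c = c' := by
  subst h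
  refine ⟨funext fun i => ?_, funext fun i => ?_, funext fun i => ?_⟩
  · simpa [join] using congrFun e (Fin.castAdd n₃ (Fin.castAdd n₂ i))
  · simpa [join] using congrFun e (Fin.castAdd n₃ (Fin.natAdd n₁ i))
  · simpa [join] using congrFun e (Fin.natAdd (n₁ + n₂) i)

theorem mem_zStrings {m : ℕ} {p : PauliString m} : p ∈ zStrings m ↔ ∀ i, p i ∈ zLetters := by
  simp [zStrings, mem_zLetters]

theorem mul_mem_zStrings {m : ℕ} {p q : PauliString m} (hp : p ∈ zStrings m)
    (hq : q ∈ zStrings m) : p * q ∈ zStrings m :=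
  mem_zStrings.mpr fun i => mul_mem (mem_zStrings.mp hp i) (mem_zStrings.mp hq i)

theorem forall_blocks (h : n₁ + n₂ + n₃ = n) {p : Fin n → Prop} : (∀ i, p i) ↔
    (∀ i, p (Fin.cast h (Fin.castAdd n₃ (Fin.castAdd n₂ i)))) ∧
      (∀ i, p (Fin.cast h (Fin.castAdd n₃ (Fin.natAdd n₁ i)))) ∧
      ∀ i, p (Fin.cast h (Fin.natAdd (n₁ + n₂) i)) := by
  subst h
  refine ⟨fun hp => ⟨fun _ => hp _, fun _ => hp _, fun _ => hp _⟩, fun hp i => ?_⟩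
  exact Fin.addCases (fun j => Fin.addCases (fun k => hp.1 k) (fun k => hp.2.1 k) j)
    (fun j => hp.2.2 j) i

theorem join_mem_std (h : n₁ + n₂ + n₃ = n) {a : PauliString n₁} {b : PauliString n₂}
    {c : PauliString n₃} : join h a b c ∈ std n n₁ n₂ ↔ b ∈ zStrings n₂ ∧ c = 1 := by
  rw [mem_std, forall_blocks h, mem_zStrings, funext_iff]
  subst h
  constructor
  · rintro ⟨-, h2, h3⟩
    exact ⟨fun i => by simpa [join] using (h2 i).1, fun i => by simpa [join] using (h3 i).2⟩
  · rintro ⟨h2, h3⟩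
    refine ⟨fun i => ⟨fun hi => ?_, fun hi => ?_⟩, fun i => ⟨fun _ => ?_, fun hi => ?_⟩, fun i => ?_⟩
    · simp at hi; omega
    · simp at hi; omega
    · simpa [join] using h2 i
    · simp at hi; omega
    · have : c i = 1 := h3 i
      simp [join, this, one_mem]

theorem join_mem_perp_std (h : n₁ + n₂ + n₃ = n) {a : PauliString n₁} {b : PauliString n₂}
    {c : PauliString n₃} : join h a b c ∈ perp (std n n₁ n₂) ↔ a = 1 ∧ b ∈ zStrings n₂ := by
  rw [mem_perp_std, forall_blocks h, mem_zStrings, funext_iff]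
  subst h
  constructor
  · rintro ⟨h1, h2, -⟩
    exact ⟨fun i => by simpa [join] using (h1 i).1, fun i => by simpa [join] using (h2 i).2⟩
  · rintro ⟨h1, h2⟩
    refine ⟨fun i => ?_, fun i => ⟨fun hi => ?_, fun _ => ?_⟩, fun i => ⟨fun hi => ?_, fun hi => ?_⟩⟩
    · have : a i = 1 := h1 i
      simp [join, this, one_mem]
    · simp at hi
    · simpa [join] using h2 i
    · simp at hi; omega
    · simp at hi

/-! ### Rotated Pauli operators -/

theorem phaseEq_rotated (h : n₁ + n₂ + n₃ = n) (W : cliffordGroup n) (a : PauliString n₁)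
    (b : PauliString n₂) (c : PauliString n₃) :
    PhaseEq (rotated h W (pauli a) (pauli b) (pauli c)) (pauli (W⁻¹ • join h a b c)) := by
  have := phaseEq_smul W⁻¹ (join h a b c)
  rw [rotated, tensor_pauli]
  convert this using 1
  change _ = star ((W : UnitaryOp n) : Op n) * _ * star (star ((W : UnitaryOp n) : Op n))
  rw [star_star]

theorem PhaseEq.rotated_middle (h : n₁ + n₂ + n₃ = n) (W : UnitaryOp n) (A : Op n₁) (C : Op n₃)
    {B B' : Op n₂} : PhaseEq B B' → PhaseEq (rotated h W A B C) (rotated h W A B' C) := by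
  rintro ⟨c, hc, rfl⟩
  refine PhaseEq.conj _ _ ⟨c, hc, ?_⟩
  ext x y
  simp only [tensor, Matrix.of_apply, Matrix.smul_apply, smul_eq_mul]
  ring

theorem phaseEq_pauli_rotated_iff (h : n₁ + n₂ + n₃ = n) (W : cliffordGroup n)
    {p : PauliString n} {a : PauliString n₁} {b : PauliString n₂} {c : PauliString n₃} :
    PhaseEq (pauli p) (rotated h W (pauli a) (pauli b) (pauli c)) ↔ W • p = join h a b c := by
  rw [← eq_inv_smul_iff, ← phaseEq_pauli_iff]
  exact ⟨fun h' => h'.trans (phaseEq_rotated h W a b c),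
    fun h' => h'.trans (phaseEq_rotated h W a b c).symm⟩

/-- Every element of Q is a phase times a Pauli operator, so passing from unitaries to strings loses
nothing. -/
theorem decomposes_iff (h : n₁ + n₂ + n₃ = n) {Q : Subgroup (UnitaryOp n)} (hQ : Q ≤ pauliGroup n)
    (W : cliffordGroup n) : Decomposes h Q W ↔ preimage W (std n n₁ n₂) = labels Q := by
  have h1 : (1 : Op n₃) = pauli 1 := (pauli_idString n₃).symm
  have hstd : ∀ p, p ∈ preimage W (std n n₁ n₂) ↔ ∃ s₁ : PauliString n₁, ∃ s₂ ∈ zStrings n₂,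
      PhaseEq (pauli p) (rotated h W (pauli s₁) (pauli s₂) 1) := by
    intro p
    simp only [h1, phaseEq_pauli_rotated_iff, mem_preimage]
    constructor
    · intro hp
      obtain ⟨a, b, c, e⟩ := exists_join h (W • p)
      rw [e, join_mem_std] at hp
      exact ⟨a, b, hp.1, by rw [e, hp.2]⟩
    · rintro ⟨a, b, hb, e⟩
      rw [e, join_mem_std]
      exact ⟨hb, rfl⟩
  constructor
  · intro hd
    ext p
    rw [hstd, mem_labels]
    exact (hd (pauliUnitary p)).symm
  · intro e V
    constructor
    · rintro ⟨R, hR, hV⟩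
      obtain ⟨p, hp⟩ := exists_string_of_mem_pauliGroup (hQ hR)
      have hp' : p ∈ labels Q := ⟨R, hR, hp.symm⟩
      rw [← e, hstd] at hp'
      obtain ⟨a, b, hb, h'⟩ := hp'
      exact ⟨a, b, hb, hV.trans (hp.trans h')⟩
    · rintro ⟨a, b, hb, hV⟩
      rw [h1] at hV
      have hV' := hV.trans (phaseEq_rotated h W a b 1)
      have hp : W⁻¹ • join h a b 1 ∈ labels Q := by
        rw [← e, mem_preimage, smul_inv_smul, join_mem_std]
        exact ⟨hb, rfl⟩
      obtain ⟨R, hR, hp⟩ := hp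
      exact ⟨R, hR, hV'.trans hp⟩

theorem exists_decomposes {Q : Subgroup (UnitaryOp n)} (hQ : Q ≤ pauliGroup n) :
    ∃ (n₁ n₂ n₃ : ℕ) (h : n₁ + n₂ + n₃ = n), ∃ W ∈ cliffordGroup n, Decomposes h Q W := by
  obtain ⟨k, l, hkl, C, hC⟩ := exists_preimage_eq_std (labels Q)
  refine ⟨k, l, n - (k + l), by omega, C, C.2, (decomposes_iff _ hQ C).mpr ?_⟩
  ext p
  rw [← hC, mem_preimage, mem_preimage, inv_smul_smul]

end SymClifford

end

open SymClifford

theorem theoremS1 {n : ℕ} (U : UnitaryOp n) :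
    -- the decomposition of `𝒬_U` exists
    (∃ (n₁ n₂ n₃ : ℕ) (h : n₁ + n₂ + n₃ = n), ∃ W ∈ cliffordGroup n,
      Decomposes h (symmetryGroup U) W) ∧
    -- and for every such decomposition and every Pauli operator `P`
    ∀ (n₁ n₂ n₃ : ℕ) (h : n₁ + n₂ + n₃ = n), ∀ W ∈ cliffordGroup n,
      Decomposes h (symmetryGroup U) W →
      ∀ P : PauliString n,
        (∃ (P₁ : PauliString n₁) (P₂ : PauliString n₂) (P₃ : PauliString n₃),
          PhaseEq (pauli P) (rotated h W (pauli P₁) (pauli P₂) (pauli P₃))) ∧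
        ∀ (P₁ : PauliString n₁) (P₂ : PauliString n₂) (P₃ : PauliString n₃),
          PhaseEq (pauli P) (rotated h W (pauli P₁) (pauli P₂) (pauli P₃)) →
          (P₂ ∉ zStrings n₂ →
            twirl (symmetryGroup U) (conjChannel (pauli P)) =
              average (zStrings n₂ ×ˢ (Finset.univ : Finset (PauliString n₃))) fun Q =>
                conjChannel (rotated h W (pauli P₁) (pauli P₂ * pauli Q.1) (pauli Q.2))) ∧
          (P₂ ∈ zStrings n₂ → P₃ ≠ idString n₃ →
            twirl (symmetryGroup U) (conjChannel (pauli P)) =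
              average (zStrings n₂ ×ˢ (Finset.univ.erase (idString n₃))) fun Q =>
                conjChannel (rotated h W (pauli P₁) (pauli Q.1) (pauli Q.2))) ∧
          (P₂ ∈ zStrings n₂ → P₃ = idString n₃ →
            twirl (symmetryGroup U) (conjChannel (pauli P)) = conjChannel (pauli P)) := by
  have hU := symmetryGroup_le U
  refine ⟨exists_decomposes hU, ?_⟩
  intro n₁ n₂ n₃ h W' hW' hdec P
  obtain ⟨W, rfl⟩ : ∃ W : cliffordGroup n, (W : UnitaryOp n) = W' := ⟨⟨W', hW'⟩, rfl⟩
  have hS := (decomposes_iff h hU W).mp hdec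
  simp only [phaseEq_pauli_rotated_iff]
  refine ⟨exists_join h (W • P), fun P₁ P₂ P₃ hP => ?_⟩
  have hmem : ∀ q a b c, W • q = join h a b c →
      (q ∈ labels (symmetryGroup U) ↔ b ∈ zStrings n₂ ∧ c = 1) := by
    intro q a b c e
    rw [← hS, mem_preimage, e, join_mem_std]
  -- The orbit criterion in block coordinates: membership of the product in the complement forces
  -- equal first blocks and second blocks differing by {I,Z}, and leaves the third free.
  have horb : P ∉ labels (symmetryGroup U) → ∀ q a b c, W • q = join h a b c →
      ((∃ C : cliffordGroup n, (C : UnitaryOp n) ∈ symmetricCliffordGroup (symmetryGroup U) ∧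
        C • P = q) ↔ ¬ (b ∈ zStrings n₂ ∧ c = 1) ∧ P₁ = a ∧ P₂ * b ∈ zStrings n₂) := by
    intro hPS q a b c e
    simp only [mem_symmetricCliffordGroup_iff hU]
    rw [exists_fixing_smul_eq_iff (hS ▸ fun u => exists_sign_of_not_mem_preimage_std W) hPS,
      hmem q a b c e, ← hS, mem_perp_preimage_iff, smul_mul', hP, e, join_mul_join,
      join_mem_perp_std, mul_eq_one_iff_eq_inv]
    rfl
  have hz : ∀ b : PauliString n₂, P₂ * (P₂ * b) = b := fun b => by
    rw [← mul_assoc, string_mul_self, one_mul]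
  refine ⟨fun h2 => ?_, fun h2 h3 => ?_, fun h2 h3 => ?_⟩
  · have hPS : P ∉ labels (symmetryGroup U) := fun hPS => h2 ((hmem P _ _ _ hP).mp hPS).1
    rw [twirl_eq_average (symmetryGroup U) P (zStrings n₂ ×ˢ Finset.univ)
      (fun Q => W⁻¹ • join h P₁ (P₂ * Q.1) Q.2)]
    · refine congrArg _ (funext fun Q => PhaseEq.conjChannel_eq ?_)
      exact (phaseEq_rotated h W _ _ _).symm.trans
        ((phaseEq_pauli_mul P₂ Q.1).symm.rotated_middle h _ _ _)
    · intro Q _ Q' _ e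
      obtain ⟨-, e2, e3⟩ := join_inj h ((MulAction.injective W⁻¹) e)
      exact Prod.ext (mul_left_cancel e2) e3
    · intro q
      obtain ⟨a, b, c, e⟩ := exists_join h (W • q)
      rw [horb hPS q a b c e]
      constructor
      · rintro ⟨Q, hQ, rfl⟩
        rw [smul_inv_smul] at e
        obtain ⟨rfl, rfl, rfl⟩ := join_inj h e
        have hQ1 := (Finset.mem_product.mp hQ).1
        -- Avoiding the symmetry group is automatic here: a second block in {I,Z} after
        -- multiplication by Q₂ would put P₂ there as well.
        refine ⟨fun hb => h2 ?_, rfl, by rwa [hz]⟩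
        have := mul_mem_zStrings hb.1 hQ1
        rwa [mul_assoc, string_mul_self, mul_one] at this
      · rintro ⟨-, rfl, hb⟩
        refine ⟨(P₂ * b, c), Finset.mem_product.mpr ⟨hb, Finset.mem_univ _⟩, ?_⟩
        rw [hz, ← e, inv_smul_smul]
  · have hPS : P ∉ labels (symmetryGroup U) := fun hPS => h3 ((hmem P _ _ _ hP).mp hPS).2
    rw [twirl_eq_average (symmetryGroup U) P (zStrings n₂ ×ˢ Finset.univ.erase (idString n₃))
      (fun Q => W⁻¹ • join h P₁ Q.1 Q.2)]
    · refine congrArg _ (funext fun Q => PhaseEq.conjChannel_eq ?_)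
      exact (phaseEq_rotated h W _ _ _).symm
    · intro Q _ Q' _ e
      obtain ⟨-, e2, e3⟩ := join_inj h ((MulAction.injective W⁻¹) e)
      exact Prod.ext e2 e3
    · intro q
      obtain ⟨a, b, c, e⟩ := exists_join h (W • q)
      rw [horb hPS q a b c e]
      constructor
      · rintro ⟨Q, hQ, rfl⟩
        rw [smul_inv_smul] at e
        obtain ⟨rfl, rfl, rfl⟩ := join_inj h e
        obtain ⟨hQ1, hQ2⟩ := Finset.mem_product.mp hQ
        exact ⟨fun hb => (Finset.mem_erase.mp hQ2).1 hb.2, rfl, mul_mem_zStrings h2 hQ1⟩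
      · rintro ⟨hbc, rfl, hb⟩
        have hb' : b ∈ zStrings n₂ := hz b ▸ mul_mem_zStrings h2 hb
        refine ⟨(b, c), Finset.mem_product.mpr
          ⟨hb', Finset.mem_erase.mpr ⟨fun hc => hbc ⟨hb', hc⟩, Finset.mem_univ _⟩⟩, ?_⟩
        rw [← e, inv_smul_smul]
  · have hPS : P ∈ labels (symmetryGroup U) := (hmem P _ _ _ hP).mpr ⟨h2, h3⟩
    -- The orbit of a string of the symmetry group is a single point.
    rw [twirl_eq_average (symmetryGroup U) P ({P} : Finset (PauliString n)) id
      Function.injective_id.injOn]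
    · simp [average]
    · intro q
      simp only [mem_symmetricCliffordGroup_iff hU, Finset.mem_singleton, id, exists_eq_left]
      constructor
      · rintro rfl
        exact ⟨1, fun s _ => Commute.one_left _, one_smul _ _⟩
      · rintro ⟨C, hC, rfl⟩
        exact (smul_of_mem_fixing hC hPS).symm
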